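/- Let $F$ be a subfield of $\mathbb{R}$ and let $K\subset\mathbb{R}$ be a nonempty finite union of closed intervals (possibly unbounded or reduced to a point) such that $[F(c):F]\le 2$ for every $c\in\partial K$. Suppose that, whenever $c<c'$ are conjugate over $F$ with $[F(c):F]=2$ and at least one of $c,c'$ lies in $\partial K$, then both lie in $\partial K$ and either $K=[c,c']$ or $(c,c')\cap K=\emptyset$. Suppose also that no $c\in\partial K$ with $[F(c):F]=2$ is an isolated point of $K$. Define the set $\mathcal N$ of natural generators of $K$ as follows. If $K=\mathbb{R}$, let $\mathcal N=\{1\}$. If $K=[c,c']$ with $c<c'$ conjugate over $F$ and $[F(c):F]=2$, let $\mathcal N=\{-(x-c)(x-c')\}$. Otherwise, $\mathcal N$ consists of $x-a$ if $K$ has a least element $a$, of $a-x$ if $K$ has a greatest element $a$, and of $(x-a)(x-b)$ for all $a<b$ in $\partial K$ with $(a,b)\cap K=\emptyset$. Then $\mathcal N\subset F[x]$ and $$\mathrm{Pos}(K)=T_{\mathcal N},$$ where $\mathrm{Pos}(K)=\{f\in F[x]: f\ge 0\text{ on }K\}$ and $T_{\mathcal N}$ is the set of all finite sums of terms $a\,q^2\prod_{g\in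 E}g$ with $a\in F$, $a\ge 0$, $q\in F[x]$ and $E\subseteq\mathcal N$. -/

import Mathlib

open Polynomial

/-- A nonempty closed interval of the real line: `[a, b]` with `a ≤ b` (a single point if `a = b`),
`[a, ∞)`, `(-∞, a]`, or the whole line. -/
def IsClosedInterval (I : Set ℝ) : Prop :=
  (∃ a b : ℝ, a ≤ b ∧ I = Set.Icc a b) ∨ (∃ a : ℝ, I = Set.Ici a) ∨
    (∃ a : ℝ, I = Set.Iic a) ∨ I = Set.univ

/-- `K` is a union of finitely many closed intervals. -/
def IsFiniteUnionOfClosedIntervals (K : Set ℝ) : Prop :=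
  ∃ I : Set (Set ℝ), I.Finite ∧ (∀ J ∈ I, IsClosedInterval J) ∧ K = ⋃₀ I

/-- `c < c'` are the two roots of an irreducible quadratic polynomial over `F`: `[F(c) : F] = 2`,
and `c` and `c'` have the same minimal polynomial over `F`. -/
def IsQuadraticConjugatePair (F : Subfield ℝ) (c c' : ℝ) : Prop :=
  c < c' ∧ Module.finrank F (IntermediateField.adjoin F {c}) = 2 ∧ IsConjRoot F c c'

/-- The natural generators of `K`, as real polynomials.
* `1`, if `K = ℝ`;
* `-(x - c)(x - c')`, if `K = [c, c']` for a quadratic conjugate pair `c < c'` over `F`;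
* otherwise `x - a` for the least element `a` of `K` (if there is one), `a - x` for the greatest
  element `a` of `K` (if there is one), and `(x - a)(x - b)` for each bounded gap `(a, b)`. -/
def naturalGenerators (F : Subfield ℝ) (K : Set ℝ) : Set ℝ[X] :=
  {g | (K = Set.univ ∧ g = 1) ∨
    (∃ c c' : ℝ, IsQuadraticConjugatePair F c c' ∧ K = Set.Icc c c' ∧
      g = -((X - C c) * (X - C c'))) ∨
    ((¬ ∃ c c' : ℝ, IsQuadraticConjugatePair F c c' ∧ K = Set.Icc c c') ∧
      ((∃ a ∈ frontier K, Set.Iio a ∩ K = ∅ ∧ g = X - C a) ∨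
       (∃ a ∈ frontier K, Set.Ioi a ∩ K = ∅ ∧ g = C a - X) ∨
       (∃ a ∈ frontier K, ∃ b ∈ frontier K, a < b ∧ Set.Ioo a b ∩ K = ∅ ∧
          g = (X - C a) * (X - C b))))}

/-- `Pos(K)`: the polynomials over `F` that are nonnegative on `K`. -/
def posPolynomials (F : Subfield ℝ) (K : Set ℝ) : Set F[X] :=
  {f | ∀ x ∈ K, 0 ≤ aeval x f}

/-- The preordering `T_S` of `F[x]`: all finite sums of terms `a q² ∏_{g ∈ E} g` with `a ∈ F`,
`a ≥ 0`, `q ∈ F[x]` and `E` a finite subset of `S`. -/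
def preordering (F : Subfield ℝ) (S : Set F[X]) : Set F[X] :=
  (AddSubmonoid.closure
    {p : F[X] | ∃ (a : F) (q : F[X]) (E : Finset F[X]),
      0 ≤ a ∧ (E : Set F[X]) ⊆ S ∧ p = C a * q ^ 2 * ∏ g ∈ E, g} : AddSubmonoid F[X])

/-! Over `ℝ` the statement holds without increase of degree (`mem_truncatedPreordering_of_nonneg`).
If `f ≥ 0` on `K` is negative at `t`, then `t` lies in a gap of `K`, and the zeros of `f` nearest to
`t` in that gap or at its ends give a factor which is a nonnegative combination of the generator of
the gap and squares. If `f` is nowhere negative, its roots give factors that are squares or sums of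
two squares. The cofactor is again nonnegative on `K`, and induction on the degree applies.

To descend to `F`, one would like to approximate real coefficients by elements of `F`. This works
for an interior point of a cone (`mem_of_closure_mem_nhds`), but the zeros of `f` in `K` put `f` on
the boundary. Squares of minimal polynomials at accumulation points of `K` are therefore split off
first. Let `p` be the product of the `X - c` over the remaining zeros `c` of `f` in `K`. These are
boundary points, the set of them is closed under conjugation, so `p` is defined over `F` and `f = p
* h`. Now `h` has no zero on the closure of the rest of `K`, so small changes of `h` keep `p * h`
nonnegative on `K`: among multiples of `p`, `f` is interior. A term of a real representation of a
multiple of `p` is itself divisible by `p`, in a way that is visible over `F`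
(`mul_mem_preordering_of_eventually`), so the real cone lies in the closure of the cone over `F`. -/

/-! ### Real preorderings with a degree bound -/

/-- The sums of terms `q² ∏_{g ∈ E} g` of degree at most `D`, where `E ⊆ S` is finite. -/
noncomputable def truncatedPreordering (S : Set ℝ[X]) (D : ℕ) : AddSubmonoid ℝ[X] :=
  AddSubmonoid.closure {p | ∃ (q : ℝ[X]) (E : Finset ℝ[X]),
    (E : Set ℝ[X]) ⊆ S ∧ p = q ^ 2 * ∏ g ∈ E, g ∧ p.natDegree ≤ D}

/-- The generators of a closed set `K` attached to its least element, its greatest element and its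
bounded gaps. -/
def gapGenerators (K : Set ℝ) : Set ℝ[X] :=
  {g | (∃ a ∈ frontier K, Set.Iio a ∩ K = ∅ ∧ g = X - C a) ∨
       (∃ a ∈ frontier K, Set.Ioi a ∩ K = ∅ ∧ g = C a - X) ∨
       (∃ a ∈ frontier K, ∃ b ∈ frontier K, a < b ∧ Set.Ioo a b ∩ K = ∅ ∧
          g = (X - C a) * (X - C b))}

/-- Generators common to two terms move into the square, so products of terms are again terms. -/
theorem prod_mul_prod_eq_sq_mul_prod {R : Type*} [CommRing R] [DecidableEq R] (E E' : Finset R) :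
    (∏ g ∈ E, g) * ∏ g ∈ E', g =
      (∏ g ∈ E ∩ E', g) ^ 2 * ∏ g ∈ (E ∪ E') \ (E ∩ E'), g := by
  rw [← Finset.prod_union_inter, ← Finset.prod_sdiff (s₁ := E ∩ E') (s₂ := E ∪ E')
    (Finset.inter_subset_left.trans Finset.subset_union_left)]
  ring

namespace truncatedPreordering

variable {S : Set ℝ[X]}

theorem mul_mem {a b : ℕ} {f g : ℝ[X]} (hf : f ∈ truncatedPreordering S a)
    (hg : g ∈ truncatedPreordering S b) : f * g ∈ truncatedPreordering S (a + b) := by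
  classical
  induction hf using AddSubmonoid.closure_induction with
  | zero => simp
  | add x y _ _ hx hy => rw [add_mul]; exact add_mem hx hy
  | mem x hx =>
    obtain ⟨q, E, hE, rfl, hd⟩ := hx
    induction hg using AddSubmonoid.closure_induction with
    | zero => simp
    | add x y _ _ hx hy => rw [mul_add]; exact add_mem hx hy
    | mem y hy =>
      obtain ⟨r, E', hE', rfl, hd'⟩ := hy
      refine AddSubmonoid.subset_closure
        ⟨q * r * ∏ g ∈ E ∩ E', g, (E ∪ E') \ (E ∩ E'), ?_, ?_, ?_⟩
      · intro x hx
        simp only [Finset.coe_sdiff, Finset.coe_union, Set.mem_sdiff, Set.mem_union] at hx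
        exact hx.1.elim (fun h => hE h) (fun h => hE' h)
      · have := prod_mul_prod_eq_sq_mul_prod E E'
        linear_combination (q ^ 2 * r ^ 2) * this
      · exact natDegree_mul_le.trans (add_le_add hd hd')

theorem sq_mem {q : ℝ[X]} {D : ℕ} (h : (q ^ 2).natDegree ≤ D) :
    q ^ 2 ∈ truncatedPreordering S D :=
  AddSubmonoid.subset_closure ⟨q, ∅, by simp, by simp, h⟩

theorem C_mem {a : ℝ} (ha : 0 ≤ a) (D : ℕ) : C a ∈ truncatedPreordering S D := by
  have : C a = (C (√a)) ^ 2 := by rw [← C_pow, Real.sq_sqrt ha]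
  rw [this]
  exact sq_mem (by rw [← C_pow]; simp)

theorem C_mul_mem {a : ℝ} (ha : 0 ≤ a) {D : ℕ} {f : ℝ[X]}
    (hf : f ∈ truncatedPreordering S D) : C a * f ∈ truncatedPreordering S D := by
  simpa using mul_mem (C_mem (S := S) ha 0) hf

theorem generator_mem {g : ℝ[X]} (hg : g ∈ S) {D : ℕ} (h : g.natDegree ≤ D) :
    g ∈ truncatedPreordering S D :=
  AddSubmonoid.subset_closure ⟨1, {g}, by simpa, by simp, h⟩

theorem mono {D D' : ℕ} (h : D ≤ D') :
    truncatedPreordering S D ≤ truncatedPreordering S D' := by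
  refine AddSubmonoid.closure_mono ?_
  rintro p ⟨q, E, hE, hp, hd⟩
  exact ⟨q, E, hE, hp, hd.trans h⟩

theorem sub_C_sq_mem (d : ℝ) : (X - C d) ^ 2 ∈ truncatedPreordering S 2 :=
  sq_mem (by simp [natDegree_pow])

/-- Moving the roots of `(X - a) * (X - b)` towards each other. -/
theorem gap_mem {a b d e : ℝ} (had : a ≤ d) (hde : d < e) (heb : e ≤ b)
    (h : (X - C a) * (X - C b) ∈ S) :
    (X - C d) * (X - C e) ∈ truncatedPreordering S 2 := by
  have hea : 0 < e - a := by linarith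
  have hba : 0 < b - a := by linarith
  have h0 : (X - C a) * (X - C b) ∈ truncatedPreordering S 2 := by
    refine generator_mem h ?_
    refine natDegree_mul_le.trans ?_
    simp
  have h1 : (X - C a) * (X - C e) ∈ truncatedPreordering S 2 := by
    -- `(X - a)(X - e)` is affine in `e` and a square at `e = a`, so it interpolates between that
    -- square and the generator at `e = b`. The other root is moved in the same way.
    have : (X - C a) * (X - C e) = C ((e - a) / (b - a)) * ((X - C a) * (X - C b)) +
        C ((b - e) / (b - a)) * (X - C a) ^ 2 := by
      refine Polynomial.funext fun x => ?_
      simp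
      field_simp
      ring
    rw [this]
    exact add_mem (C_mul_mem (by positivity) h0)
      (C_mul_mem (div_nonneg (by linarith) hba.le) (sub_C_sq_mem a))
  have : (X - C d) * (X - C e) = C ((e - d) / (e - a)) * ((X - C a) * (X - C e)) +
      C ((d - a) / (e - a)) * (X - C e) ^ 2 := by
    refine Polynomial.funext fun x => ?_
    simp
    field_simp
    ring
  rw [this]
  exact add_mem (C_mul_mem (div_nonneg (by linarith) hea.le) h1)
    (C_mul_mem (div_nonneg (by linarith) hea.le) (sub_C_sq_mem e))

theorem X_sub_C_mem {a e : ℝ} (h : e ≤ a) (ha : X - C a ∈ S) :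
    X - C e ∈ truncatedPreordering S 1 := by
  have : X - C e = (X - C a) + C (a - e) := by simp
  rw [this]
  exact add_mem (generator_mem ha (by simp)) (C_mem (by linarith) 1)

theorem C_sub_X_mem {a e : ℝ} (h : a ≤ e) (ha : C a - X ∈ S) :
    C e - X ∈ truncatedPreordering S 1 := by
  have : C e - X = (C a - X) + C (e - a) := by simp
  rw [this]
  refine add_mem (generator_mem ha ?_) (C_mem (by linarith) 1)
  exact (natDegree_sub_le _ _).trans (by simp)

end truncatedPreordering

/-! ### Roots in the gaps of a closed set, and the theorem over the reals -/

theorem exists_last_root {f : ℝ → ℝ} (hf : Continuous f) {a t : ℝ} (hat : a ≤ t) (ha : 0 ≤ f a)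
    (ht : f t < 0) : ∃ d, a ≤ d ∧ d < t ∧ f d = 0 ∧ ∀ x, d < x → x ≤ t → f x < 0 := by
  have hc : IsCompact (Set.Icc a t ∩ {x | 0 ≤ f x}) :=
    isCompact_Icc.inter_right (isClosed_le continuous_const hf)
  obtain ⟨d, ⟨⟨had, hdt⟩, hd⟩, hmax⟩ := hc.exists_isGreatest ⟨a, ⟨le_rfl, hat⟩, ha⟩
  have hd : 0 ≤ f d := hd
  have hne : d < t := lt_of_le_of_ne hdt (by rintro rfl; linarith)
  have hneg : ∀ x, d < x → x ≤ t → f x < 0 := by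
    intro x hx hxt
    by_contra hcon
    exact absurd (hmax ⟨⟨had.trans hx.le, hxt⟩, not_lt.1 hcon⟩) (not_le.2 hx)
  refine ⟨d, had, hne, le_antisymm ?_ hd, hneg⟩
  refine le_of_tendsto (x := nhdsWithin d (Set.Ioi d)) (f := f) hf.continuousWithinAt ?_
  · filter_upwards [Ioc_mem_nhdsGT hne] with x hx using (hneg x hx.1 hx.2).le

theorem exists_first_root {f : ℝ → ℝ} (hf : Continuous f) {b t : ℝ} (hbt : t ≤ b) (hb : 0 ≤ f b)
    (ht : f t < 0) : ∃ e, e ≤ b ∧ t < e ∧ f e = 0 ∧ ∀ x, x < e → t ≤ x → f x < 0 := by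
  obtain ⟨d, h1, h2, h3, h4⟩ := exists_last_root (f := fun x => f (-x)) (by fun_prop)
    (neg_le_neg hbt) (by simpa) (by simpa)
  refine ⟨-d, by linarith, by linarith, h3, fun x hx hx' => ?_⟩
  simpa using h4 (-x) (by linarith) (by linarith)

theorem nonneg_of_nonneg_on_Ioo {g : ℝ[X]} {u v : ℝ} (huv : u < v)
    (h : ∀ x ∈ Set.Ioo u v, 0 ≤ g.eval x) : 0 ≤ g.eval u ∧ 0 ≤ g.eval v := by
  have hs : closure (Set.Ioo u v) ⊆ {x | 0 ≤ g.eval x} :=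
    closure_minimal h (isClosed_le continuous_const g.continuous)
  rw [closure_Ioo huv.ne] at hs
  exact ⟨hs ⟨le_rfl, huv.le⟩, hs ⟨huv.le, le_rfl⟩⟩

theorem mem_frontier_of_Ioo_right {K : Set ℝ} {a b : ℝ} (ha : a ∈ K) (hab : a < b)
    (h : Set.Ioo a b ∩ K = ∅) : a ∈ frontier K := by
  refine ⟨subset_closure ha, fun hi => ?_⟩
  have h1 : ∀ᶠ x in nhdsWithin a (Set.Ioi a), x ∈ K :=
    nhdsWithin_le_nhds (mem_interior_iff_mem_nhds.1 hi)
  obtain ⟨x, hx, hx'⟩ := (h1.and (Ioo_mem_nhdsGT hab)).exists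
  exact Set.notMem_empty x (h ▸ ⟨hx', hx⟩)

theorem mem_frontier_of_Ioo_left {K : Set ℝ} {a b : ℝ} (hb : b ∈ K) (hab : a < b)
    (h : Set.Ioo a b ∩ K = ∅) : b ∈ frontier K := by
  refine ⟨subset_closure hb, fun hi => ?_⟩
  have h1 : ∀ᶠ x in nhdsWithin b (Set.Iio b), x ∈ K :=
    nhdsWithin_le_nhds (mem_interior_iff_mem_nhds.1 hi)
  obtain ⟨x, hx, hx'⟩ := (h1.and (Ioo_mem_nhdsLT hab)).exists
  exact Set.notMem_empty x (h ▸ ⟨hx', hx⟩)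

/-- The last point of a closed set to the left of `t`. -/
theorem exists_gap_left {K : Set ℝ} (hK : IsClosed K) {t : ℝ} (ht : t ∉ K)
    (hne : (K ∩ Set.Iic t).Nonempty) : ∃ a ∈ K, a < t ∧ Set.Ioc a t ∩ K = ∅ := by
  have hcl : IsClosed (K ∩ Set.Iic t) := hK.inter isClosed_Iic
  have hbd : BddAbove (K ∩ Set.Iic t) := ⟨t, fun x hx => hx.2⟩
  have hm := hcl.csSup_mem hne hbd
  refine ⟨_, hm.1, lt_of_le_of_ne hm.2 (fun h => ht (h ▸ hm.1)), ?_⟩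
  rw [Set.eq_empty_iff_forall_notMem]
  rintro x ⟨⟨h1, h2⟩, hx⟩
  exact absurd (le_csSup hbd ⟨hx, h2⟩) (not_le.2 h1)

theorem exists_gap_right {K : Set ℝ} (hK : IsClosed K) {t : ℝ} (ht : t ∉ K)
    (hne : (K ∩ Set.Ici t).Nonempty) : ∃ b ∈ K, t < b ∧ Set.Ico t b ∩ K = ∅ := by
  have hcl : IsClosed (K ∩ Set.Ici t) := hK.inter isClosed_Ici
  have hbd : BddBelow (K ∩ Set.Ici t) := ⟨t, fun x hx => hx.2⟩
  have hm := hcl.csInf_mem hne hbd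
  refine ⟨_, hm.1, lt_of_le_of_ne hm.2 (fun h => ht (h ▸ hm.1)), ?_⟩
  rw [Set.eq_empty_iff_forall_notMem]
  rintro x ⟨⟨h1, h2⟩, hx⟩
  exact absurd (csInf_le hbd ⟨hx, h1⟩) (not_le.2 h2)

theorem exists_left_factor {K : Set ℝ} {f : ℝ[X]} (hf : ∀ x ∈ K, 0 ≤ f.eval x) {t : ℝ}
    (ht : f.eval t < 0) {a : ℝ} (ha : a ∈ K) (hta : t < a) (hgap : Set.Iio a ∩ K = ∅) :
    ∃ e ≤ a, ∃ g : ℝ[X], f = (X - C e) * g ∧ ∀ x ∈ K, 0 ≤ g.eval x := by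
  obtain ⟨e, hea, hte, he, hneg⟩ := exists_first_root f.continuous hta.le (hf a ha) ht
  obtain ⟨g, rfl⟩ := dvd_iff_isRoot.2 he
  refine ⟨e, hea, g, rfl, fun x hx => ?_⟩
  have hax : a ≤ x := by
    by_contra hcon
    exact Set.notMem_empty x (hgap ▸ ⟨not_le.1 hcon, hx⟩)
  -- At `x = e` the sign of `g` comes by continuity from `(t, e)`, where both `f` and `X - e` are
  -- negative.
  rcases (hea.trans hax).eq_or_lt with rfl | hlt
  · refine (nonneg_of_nonneg_on_Ioo hte fun y hy => ?_).2
    have := hneg y hy.2 hy.1.le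
    simp only [eval_mul, eval_sub, eval_X, eval_C] at this
    nlinarith [hy.2]
  · have := hf x hx
    simp only [eval_mul, eval_sub, eval_X, eval_C] at this
    exact nonneg_of_mul_nonneg_right this (by linarith)

theorem exists_right_factor {K : Set ℝ} {f : ℝ[X]} (hf : ∀ x ∈ K, 0 ≤ f.eval x) {t : ℝ}
    (ht : f.eval t < 0) {a : ℝ} (ha : a ∈ K) (hta : a < t) (hgap : Set.Ioi a ∩ K = ∅) :
    ∃ e, a ≤ e ∧ ∃ g : ℝ[X], f = (C e - X) * g ∧ ∀ x ∈ K, 0 ≤ g.eval x := by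
  obtain ⟨e, hea, hte, he, hneg⟩ := exists_last_root f.continuous hta.le (hf a ha) ht
  obtain ⟨g, rfl⟩ := dvd_iff_isRoot.2 he
  refine ⟨e, hea, -g, by ring, fun x hx => ?_⟩
  have hax : x ≤ a := by
    by_contra hcon
    exact Set.notMem_empty x (hgap ▸ ⟨not_le.1 hcon, hx⟩)
  rcases (hax.trans hea).eq_or_lt with rfl | hlt
  · refine (nonneg_of_nonneg_on_Ioo hte fun y hy => ?_).1
    have := hneg y hy.1 hy.2.le
    simp only [eval_mul, eval_sub, eval_X, eval_C, eval_neg] at this ⊢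
    nlinarith [hy.1]
  · have := hf x hx
    simp only [eval_mul, eval_sub, eval_X, eval_C, eval_neg] at this ⊢
    nlinarith

theorem exists_gap_factor {K : Set ℝ} {f : ℝ[X]} (hf : ∀ x ∈ K, 0 ≤ f.eval x) {t : ℝ}
    (ht : f.eval t < 0) {a b : ℝ} (ha : a ∈ K) (hb : b ∈ K) (hat : a < t) (htb : t < b)
    (hgap : Set.Ioo a b ∩ K = ∅) :
    ∃ d e, a ≤ d ∧ d < e ∧ e ≤ b ∧
      ∃ g : ℝ[X], f = (X - C d) * (X - C e) * g ∧ ∀ x ∈ K, 0 ≤ g.eval x := by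
  obtain ⟨d, had, hdt, hd, hneg⟩ := exists_last_root f.continuous hat.le (hf a ha) ht
  obtain ⟨e, heb, hte, he, hneg'⟩ := exists_first_root f.continuous htb.le (hf b hb) ht
  have hde : d < e := hdt.trans hte
  obtain ⟨f', rfl⟩ := dvd_iff_isRoot.2 hd
  have he' : f'.IsRoot e := by
    simp only [eval_mul, eval_sub, eval_X, eval_C, mul_eq_zero] at he
    exact he.resolve_left (by linarith)
  obtain ⟨g, rfl⟩ := dvd_iff_isRoot.2 he'
  have hpos : ∀ x ∈ Set.Ioo d e, 0 ≤ g.eval x := by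
    intro x hx
    have : ((X - C d) * ((X - C e) * g)).eval x < 0 := by
      rcases le_total x t with h | h
      · exact hneg x hx.1 h
      · exact hneg' x hx.2 h
    simp only [eval_mul, eval_sub, eval_X, eval_C] at this
    have h2 := mul_pos (sub_pos.2 hx.1) (sub_pos.2 hx.2)
    by_contra hcon
    nlinarith [mul_pos h2 (neg_pos.2 (not_le.1 hcon))]
  -- The roots `d`, `e` may be the endpoints of the gap, which lie in `K`; there only continuity
  -- gives the sign of `g`.
  have hends := nonneg_of_nonneg_on_Ioo hde hpos
  refine ⟨d, e, had, hde, heb, g, by ring, fun x hx => ?_⟩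
  have hfx := hf x hx
  simp only [eval_mul, eval_sub, eval_X, eval_C] at hfx
  have hout : x ≤ a ∨ b ≤ x := by
    by_contra hcon
    push Not at hcon
    exact Set.notMem_empty x (hgap ▸ ⟨hcon, hx⟩)
  by_cases hxd : x = d
  · exact hxd ▸ hends.1
  by_cases hxe : x = e
  · exact hxe ▸ hends.2
  have h3 : 0 < (x - d) * (x - e) := by
    rcases hout with h | h
    · have : x < d := lt_of_le_of_ne (h.trans had) hxd
      nlinarith
    · have : e < x := lt_of_le_of_ne (heb.trans h) (Ne.symm hxe)
      nlinarith
  rw [← mul_assoc] at hfx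
  exact nonneg_of_mul_nonneg_right hfx h3

/-- The cofactor of `X - r` is nonnegative to the right of `r` and nonpositive to the left, so it
vanishes at `r` as well. -/
theorem exists_sq_factor_of_nonneg {f : ℝ[X]} (hf : ∀ x, 0 ≤ f.eval x) {r : ℝ}
    (hr : f.IsRoot r) : ∃ g : ℝ[X], f = (X - C r) ^ 2 * g ∧ ∀ x, 0 ≤ g.eval x := by
  obtain ⟨f', rfl⟩ := dvd_iff_isRoot.2 hr
  have h1 : 0 ≤ f'.eval r := by
    refine (nonneg_of_nonneg_on_Ioo (lt_add_one r) fun y hy => ?_).1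
    have := hf y
    simp only [eval_mul, eval_sub, eval_X, eval_C] at this
    exact nonneg_of_mul_nonneg_right this (by linarith [hy.1])
  have h2 : 0 ≤ (-f').eval r := by
    refine (nonneg_of_nonneg_on_Ioo (sub_one_lt r) fun y hy => ?_).2
    have := hf y
    simp only [eval_mul, eval_sub, eval_X, eval_C, eval_neg] at this ⊢
    nlinarith [hy.2]
  have h3 : f'.IsRoot r := by
    rw [eval_neg] at h2
    exact le_antisymm (by linarith) h1
  obtain ⟨g, rfl⟩ := dvd_iff_isRoot.2 h3
  have hpos : ∀ x, x ≠ r → 0 ≤ g.eval x := by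
    intro x hx
    have := hf x
    simp only [eval_mul, eval_sub, eval_X, eval_C] at this
    rw [← mul_assoc] at this
    exact nonneg_of_mul_nonneg_right this (mul_self_pos.2 (sub_ne_zero.2 hx))
  refine ⟨g, by ring, fun x => ?_⟩
  by_cases hx : x = r
  · subst hx
    exact (nonneg_of_nonneg_on_Ioo (lt_add_one x) fun y hy => hpos y hy.1.ne').1
  · exact hpos x hx

/-- A real polynomial which is nonnegative on a closed set `K` lies in the preordering generated by
the gap generators of `K`, without any increase of degrees. -/
theorem mem_truncatedPreordering_of_nonneg {K : Set ℝ} (hK : IsClosed K) (hne : K.Nonempty)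
    (f : ℝ[X]) (hf : ∀ x ∈ K, 0 ≤ f.eval x) :
    f ∈ truncatedPreordering (gapGenerators K) f.natDegree := by
  induction hn : f.natDegree using Nat.strong_induction_on generalizing f with
  | _ n ih =>
  subst hn
  rcases eq_or_ne f 0 with rfl | hf0
  · exact zero_mem _
  -- The degrees of `Q` and `g` add up to that of `f`, so the bound survives the induction.
  have step : ∀ (D : ℕ) (Q g : ℝ[X]), 0 < Q.natDegree → Q.natDegree = D → f = Q * g →
      Q ∈ truncatedPreordering (gapGenerators K) D → (∀ x ∈ K, 0 ≤ g.eval x) →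
      f ∈ truncatedPreordering (gapGenerators K) f.natDegree := by
    rintro D Q g hQ rfl rfl hmem hg
    have hd : (Q * g).natDegree = Q.natDegree + g.natDegree :=
      natDegree_mul (left_ne_zero_of_mul hf0) (right_ne_zero_of_mul hf0)
    rw [hd]
    exact truncatedPreordering.mul_mem hmem (ih _ (by omega) g hg rfl)
  rcases Nat.eq_zero_or_pos f.natDegree with h0 | hpos
  · obtain ⟨x, hx⟩ := hne
    have hfx := hf x hx
    rw [eq_C_of_natDegree_eq_zero h0] at hfx ⊢
    exact truncatedPreordering.C_mem (by simpa using hfx) _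
  by_cases hneg : ∃ t, f.eval t < 0
  · obtain ⟨t, ht⟩ := hneg
    have htK : t ∉ K := fun h => absurd (hf t h) (not_le.2 ht)
    by_cases hl : (K ∩ Set.Iic t).Nonempty
    · obtain ⟨a, haK, hat, hgap⟩ := exists_gap_left hK htK hl
      by_cases hr : (K ∩ Set.Ici t).Nonempty
      · obtain ⟨b, hbK, htb, hgap'⟩ := exists_gap_right hK htK hr
        have hg : Set.Ioo a b ∩ K = ∅ := by
          rw [Set.eq_empty_iff_forall_notMem] at hgap hgap' ⊢
          rintro x ⟨⟨h1, h2⟩, hx⟩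
          rcases le_total x t with h | h
          · exact hgap x ⟨⟨h1, h⟩, hx⟩
          · exact hgap' x ⟨⟨h, h2⟩, hx⟩
        obtain ⟨d, e, had, hde, heb, g, hfg, hgK⟩ := exists_gap_factor hf ht haK hbK hat htb hg
        have hdeg : ((X - C d) * (X - C e)).natDegree = 2 := by
          rw [natDegree_mul (X_sub_C_ne_zero d) (X_sub_C_ne_zero e)]; simp
        refine step 2 _ g (by omega) hdeg hfg (truncatedPreordering.gap_mem had hde heb ?_) hgK
        have hab := hat.trans htb
        exact Or.inr (Or.inr ⟨a, mem_frontier_of_Ioo_right haK hab hg, b,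
          mem_frontier_of_Ioo_left hbK hab hg, hab, hg, rfl⟩)
      · have hg : Set.Ioi a ∩ K = ∅ := by
          rw [Set.eq_empty_iff_forall_notMem] at hgap ⊢
          rintro x ⟨h1, hx⟩
          rcases le_total x t with h | h
          · exact hgap x ⟨⟨h1, h⟩, hx⟩
          · exact hr ⟨x, hx, h⟩
        obtain ⟨e, hae, g, hfg, hgK⟩ := exists_right_factor hf ht haK hat hg
        have hdeg : (C e - X).natDegree = 1 := by
          rw [← neg_sub, natDegree_neg, natDegree_X_sub_C]
        refine step 1 _ g (by omega) hdeg hfg (truncatedPreordering.C_sub_X_mem hae ?_) hgK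
        refine Or.inr (Or.inl ⟨a, mem_frontier_of_Ioo_right haK (lt_add_one a) ?_, hg, rfl⟩)
        exact Set.subset_eq_empty (Set.inter_subset_inter_left _ Set.Ioo_subset_Ioi_self) hg
    · have hr : (K ∩ Set.Ici t).Nonempty := by
        obtain ⟨x, hx⟩ := hne
        exact ⟨x, hx, (le_total t x).resolve_right fun h => hl ⟨x, hx, h⟩⟩
      obtain ⟨a, haK, hta, hgap'⟩ := exists_gap_right hK htK hr
      have hg : Set.Iio a ∩ K = ∅ := by
        rw [Set.eq_empty_iff_forall_notMem] at hgap' ⊢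
        rintro x ⟨h1, hx⟩
        rcases le_total x t with h | h
        · exact hl ⟨x, hx, h⟩
        · exact hgap' x ⟨⟨h, h1⟩, hx⟩
      obtain ⟨e, hea, g, hfg, hgK⟩ := exists_left_factor hf ht haK hta hg
      have hdeg : (X - C e).natDegree = 1 := natDegree_X_sub_C e
      refine step 1 _ g (by omega) hdeg hfg (truncatedPreordering.X_sub_C_mem hea ?_) hgK
      refine Or.inl ⟨a, mem_frontier_of_Ioo_left haK (sub_one_lt a) ?_, hg, rfl⟩
      exact Set.subset_eq_empty (Set.inter_subset_inter_left _ Set.Ioo_subset_Iio_self) hg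
  · push Not at hneg
    obtain ⟨z, hz⟩ := IsAlgClosed.exists_aeval_eq_zero ℂ f (natDegree_pos_iff_degree_pos.1 hpos).ne'
    by_cases him : z.im = 0
    · have hr : f.IsRoot z.re := by
        have : z = (algebraMap ℝ ℂ) z.re := by apply Complex.ext <;> simp [him]
        rw [this, aeval_algebraMap_apply] at hz
        simpa using hz
      obtain ⟨g, hfg, hg⟩ := exists_sq_factor_of_nonneg hneg hr
      have hdeg : ((X - C z.re) ^ 2).natDegree = 2 := by simp [natDegree_pow]
      exact step 2 _ g (by omega) hdeg hfg (truncatedPreordering.sub_C_sq_mem _)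
        fun x _ => hg x
    · obtain ⟨g, hfg⟩ := quadratic_dvd_of_aeval_eq_zero_im_ne_zero f hz him
      -- Completing the square shows the real quadratic factor at `z` as a sum of two squares.
      have hQ : X ^ 2 - C (2 * z.re) * X + C (‖z‖ ^ 2) = (X - C z.re) ^ 2 + C (z.im ^ 2) := by
        rw [← Complex.normSq_eq_norm_sq, Complex.normSq_apply]
        refine Polynomial.funext fun x => ?_
        simp
        ring
      rw [hQ] at hfg
      have hdeg : ((X - C z.re) ^ 2 + C (z.im ^ 2)).natDegree = 2 := by
        rw [natDegree_add_C]; simp [natDegree_pow]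
      refine step 2 _ g (by omega) hdeg hfg (add_mem (truncatedPreordering.sub_C_sq_mem _)
        (truncatedPreordering.C_mem (sq_nonneg _) 2)) fun x hx => ?_
      have := hf x hx
      rw [hfg, eval_mul] at this
      refine nonneg_of_mul_nonneg_right this ?_
      simp
      positivity

/-! ### Interior points of cones over a subfield -/

theorem Subfield.denseRange_algebraMap (F : Subfield ℝ) : DenseRange (algebraMap F ℝ) := by
  refine Rat.denseRange_cast (𝕜 := ℝ) |>.mono ?_
  rintro _ ⟨q, rfl⟩
  exact ⟨q, by simp⟩

/-- If the real closure of a convex cone with coordinates in a subfield `F` of `ℝ` is a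
neighbourhood of a point with coordinates in `F`, then this point belongs to the cone. -/
theorem mem_of_closure_mem_nhds {F : Subfield ℝ} {ι : Type*} [Fintype ι]
    (A : AddSubmonoid (ι → F)) (hA : ∀ a : F, 0 ≤ a → ∀ v ∈ A, a • v ∈ A) (x : ι → F)
    (hx : closure ((fun (v : ι → F) i => (v i : ℝ)) '' A) ∈ nhds (fun i => (x i : ℝ))) :
    x ∈ A := by
  classical
  set emb : (ι → F) → (ι → ℝ) := fun v i => (v i : ℝ) with hemb
  -- the points `x + ε eᵢ` and `x - ε ∑ eᵢ`
  have hcont : Continuous fun ε : ℝ => ((fun i => emb x + ε • Pi.single i 1, emb x - ε • 1) :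
      (ι → ι → ℝ) × (ι → ℝ)) := by fun_prop
  have hU : ((Set.univ.pi fun _ => closure (emb '' A)) ×ˢ closure (emb '' A)) ∈
      nhds ((fun _ => emb x, emb x) : (ι → ι → ℝ) × (ι → ℝ)) :=
    prod_mem_nhds (set_pi_mem_nhds Set.finite_univ fun _ _ => hx) hx
  have hev : ∀ᶠ ε : ℝ in nhds 0, ((fun i => emb x + ε • Pi.single i 1, emb x - ε • 1) :
      (ι → ι → ℝ) × (ι → ℝ)) ∈
        ((Set.univ.pi fun _ => closure (emb '' A)) ×ˢ closure (emb '' A)) := by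
    refine hcont.continuousAt.eventually_mem ?_
    simpa using hU
  obtain ⟨δ, hδ, hball⟩ := Metric.eventually_nhds_iff.1 hev
  -- A rational `ε` lies in `F`, so dividing by it stays in `F`.
  obtain ⟨ε, hε0, hεδ⟩ := exists_rat_btwn hδ
  have hεmem := hball (y := (ε : ℝ)) (by rw [Real.dist_0_eq_abs, abs_of_pos hε0]; exact hεδ)
  rw [← closure_pi_set, ← closure_prod_eq] at hεmem
  -- the barycentric coordinates depend continuously on the vertices
  let Ψ : (ι → ι → ℝ) × (ι → ℝ) → Matrix ι ι ℝ × (ι → ℝ) := fun w =>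
    (Matrix.of fun j i => (w.1 i j - x j) / ε, fun j => (x j - w.2 j) / ε)
  have hΨ : Continuous Ψ := by
    refine Continuous.prodMk ?_ ?_
    · refine continuous_matrix fun i j => ?_
      simp only [Matrix.of_apply]
      fun_prop
    · fun_prop
  have hΨ0 : Ψ (fun i => emb x + (ε : ℝ) • Pi.single i 1, emb x - (ε : ℝ) • 1) = (1, 1) := by
    have hε0' : (ε : ℝ) ≠ 0 := hε0.ne'
    refine Prod.ext ?_ ?_
    · ext j i
      simp only [Ψ, hemb, Matrix.of_apply, Pi.add_apply, Pi.smul_apply, smul_eq_mul,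
        add_sub_cancel_left, Matrix.one_apply, Pi.single_apply]
      split_ifs <;> field_simp
    · ext j
      simp only [Ψ, hemb, Pi.sub_apply, Pi.smul_apply, smul_eq_mul, Pi.one_apply]
      field_simp
      ring
  -- For the exact simplex the system for the weights is `1 * μ = 1`. By Cramer's rule the solution
  -- varies continuously, so it stays positive for nearby vertices.
  have hpos : ∀ᶠ M : Matrix ι ι ℝ × (ι → ℝ) in nhds (1, 1),
      M.1.det ≠ 0 ∧ ∀ i, 0 < (M.1.det)⁻¹ * (M.1.adjugate.mulVec M.2) i := by
    refine Filter.Eventually.and ?_ (Filter.eventually_all.2 fun i => ?_)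
    · have : Continuous fun M : Matrix ι ι ℝ × (ι → ℝ) => M.1.det :=
        continuous_fst.matrix_det
      exact this.continuousAt.eventually_ne (by simp)
    · have h1 : ContinuousAt (fun M : Matrix ι ι ℝ × (ι → ℝ) =>
          (M.1.det)⁻¹ * (M.1.adjugate.mulVec M.2) i) (1, 1) := by
        refine ContinuousAt.mul ?_ ?_
        · exact (continuous_fst.matrix_det).continuousAt.inv₀ (by simp)
        · exact ((continuous_apply i).comp
            (continuous_fst.matrix_adjugate.matrix_mulVec continuous_snd)).continuousAt
      exact h1.eventually (lt_mem_nhds (by simp))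
  have hpos' := hΨ.continuousAt.eventually (hΨ0 ▸ hpos)
  obtain ⟨w, hw, hwmem⟩ := mem_closure_iff_nhds.1 hεmem _ hpos'
  obtain ⟨hw1, hw2⟩ := hwmem
  choose v hvA hv using fun i => hw1 i (Set.mem_univ i)
  obtain ⟨v0, hv0A, hv0⟩ := hw2
  obtain ⟨hdet, hμ⟩ := hw
  let εF : F := (ε : F)
  have hεF : ((εF : F) : ℝ) = ε := by simp [εF]
  let N : Matrix ι ι F := Matrix.of fun j i => (v i j - x j) / εF
  let y : ι → F := fun j => (x j - v0 j) / εF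
  have hN : (Ψ w).1 = N.map (algebraMap F ℝ) := by
    ext j i
    have : w.1 i j = v i j := by rw [← hv i]
    simp only [Ψ, N, this, Matrix.of_apply, Matrix.map_apply, map_div₀, map_sub, ← hεF]
    rfl
  have hy : (Ψ w).2 = fun j => algebraMap F ℝ (y j) := by
    ext j
    have : w.2 j = v0 j := by rw [← hv0]
    simp only [Ψ, y, this, map_div₀, map_sub, ← hεF]
    rfl
  have hdetN : algebraMap F ℝ N.det = (Ψ w).1.det := by
    rw [hN, RingHom.map_det]; rfl
  have hdet0 : N.det ≠ 0 := fun h => hdet (by rw [← hdetN, h, map_zero])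
  -- Cramer's rule is applied over `F`, so the weights are elements of `F`.
  let μ : ι → F := fun i => N.det⁻¹ * (N.adjugate.mulVec y) i
  have hμ0 : ∀ i, 0 ≤ μ i := by
    intro i
    have h1 := hμ i
    have h2 : algebraMap F ℝ (μ i) = ((Ψ w).1.det)⁻¹ * ((Ψ w).1.adjugate.mulVec (Ψ w).2) i := by
      rw [← hdetN, hN, hy]
      have h3 : (N.map (algebraMap F ℝ)).adjugate = N.adjugate.map (algebraMap F ℝ) :=
        ((algebraMap F ℝ).map_adjugate N).symm
      rw [h3]
      simp only [μ, map_mul, map_inv₀, RingHom.map_mulVec]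
      rfl
    rw [← h2] at h1
    exact Subtype.coe_le_coe.1 h1.le
  have hsolve : N.mulVec μ = y := by
    have : μ = N.det⁻¹ • N.adjugate.mulVec y := rfl
    rw [this, Matrix.mulVec_smul, Matrix.mulVec_mulVec, Matrix.mul_adjugate, Matrix.smul_mulVec,
      Matrix.one_mulVec, smul_smul, inv_mul_cancel₀ hdet0, one_smul]
  have hεF0 : εF ≠ 0 := fun h => hε0.ne' (by rw [← hεF, h]; rfl)
  have hsum0 : 0 ≤ ∑ i, μ i := Finset.sum_nonneg fun i _ => hμ0 i
  have hs : 0 < 1 + ∑ i, μ i := by linarith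
  -- The system `N μ = y` reads `∑ μ i • (v i - x) = x - v0`; solving for `x` gives the combination.
  have hcomb : x = (1 + ∑ i, μ i)⁻¹ • (v0 + ∑ i, μ i • v i) := by
    ext1 j
    have h1 := congrFun hsolve j
    simp only [Matrix.mulVec, dotProduct, N, y, Matrix.of_apply] at h1
    have h2 : ∑ i, (v i j - x j) * μ i = x j - v0 j := by
      have : ∑ i, (v i j - x j) / εF * μ i = (∑ i, (v i j - x j) * μ i) / εF := by
        rw [Finset.sum_div]
        exact Finset.sum_congr rfl fun i _ => by ring
      rw [this, div_left_inj' hεF0] at h1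
      exact h1
    simp only [sub_mul, Finset.sum_sub_distrib, ← Finset.mul_sum] at h2
    simp only [Pi.smul_apply, Pi.add_apply, Finset.sum_apply, smul_eq_mul]
    rw [eq_inv_mul_iff_mul_eq₀ hs.ne']
    have h3 : ∑ i, μ i * v i j = ∑ i, v i j * μ i :=
      Finset.sum_congr rfl fun i _ => mul_comm _ _
    rw [h3]
    linear_combination -h2
  rw [hcomb]
  exact hA _ (inv_nonneg.2 hs.le) _
    (add_mem hv0A (sum_mem fun i _ => hA _ (hμ0 i) _ (hvA i)))

/-! ### Quadratic boundary points and rationality of the generators -/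

/-- The hypotheses on `K`: a closed set whose boundary points have degree at most two over `F`,
where quadratic boundary points are not isolated and come in conjugate pairs bounding either `K`
or a gap of `K`. -/
structure HasQuadraticBoundary (F : Subfield ℝ) (K : Set ℝ) : Prop where
  isClosed : IsClosed K
  rank_le : ∀ c ∈ frontier K, Module.rank F (IntermediateField.adjoin F {c}) ≤ 2
  conj : ∀ c c' : ℝ, IsQuadraticConjugatePair F c c' → (c ∈ frontier K ∨ c' ∈ frontier K) →
    c ∈ frontier K ∧ c' ∈ frontier K ∧ (K = Set.Icc c c' ∨ Set.Ioo c c' ∩ K = ∅)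
  acc : ∀ c ∈ frontier K, Module.finrank F (IntermediateField.adjoin F {c}) = 2 →
    AccPt c (Filter.principal K)

section Quadratic

variable {F : Subfield ℝ} {c c' : ℝ}

theorem isIntegral_of_finrank_eq_two
    (h : Module.finrank F (IntermediateField.adjoin F {c}) = 2) : IsIntegral F c := by
  have : FiniteDimensional F (IntermediateField.adjoin F {c}) :=
    FiniteDimensional.of_finrank_pos (by omega)
  exact IntermediateField.AdjoinSimple.isIntegral_gen F c |>.1 (IsIntegral.of_finite F _)

/-- A quadratic with one real root splits over `ℝ`, and separability excludes a double root. -/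
theorem exists_conj_of_finrank_eq_two
    (h : Module.finrank F (IntermediateField.adjoin F {c}) = 2) :
    ∃ c', c' ≠ c ∧ (minpoly F c).map (algebraMap F ℝ) = (X - C c) * (X - C c') := by
  have hint := isIntegral_of_finrank_eq_two h
  have hdeg : (minpoly F c).natDegree = 2 := by
    rw [← IntermediateField.adjoin.finrank hint, h]
  have hmon := (minpoly.monic hint).map (algebraMap F ℝ)
  have hroot : ((minpoly F c).map (algebraMap F ℝ)).IsRoot c := by
    rw [IsRoot, eval_map_algebraMap, minpoly.aeval]
  obtain ⟨g, hg⟩ := dvd_iff_isRoot.2 hroot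
  have hgm : g.Monic := (monic_X_sub_C c).of_mul_monic_left (hg ▸ hmon)
  have hgd : g.natDegree = 1 := by
    have h1 := congrArg natDegree hg
    rw [natDegree_map, hdeg, (monic_X_sub_C c).natDegree_mul hgm, natDegree_X_sub_C] at h1
    omega
  have hgX : g = X - C (-g.coeff 0) := by
    rw [C_neg, sub_neg_eq_add]; exact hgm.eq_X_add_C hgd
  refine ⟨-g.coeff 0, ?_, by rw [hg, ← hgX]⟩
  intro hc
  rw [hc] at hgX
  have hsq : Squarefree ((minpoly F c).map (algebraMap F ℝ)) :=
    (Separable.map (minpoly.irreducible hint).separable).squarefree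
  rw [hg, hgX] at hsq
  exact not_isUnit_X_sub_C c (hsq _ dvd_rfl)

theorem minpoly_eq_of_root {x : ℝ} (hint : IsIntegral F c) (hx : aeval x (minpoly F c) = 0) :
    minpoly F x = minpoly F c :=
  (minpoly.eq_of_irreducible_of_monic (minpoly.irreducible hint) hx (minpoly.monic hint)).symm

theorem finrank_adjoin_eq_of_minpoly_eq (hint : IsIntegral F c) (h : minpoly F c' = minpoly F c) :
    Module.finrank F (IntermediateField.adjoin F {c'}) =
      Module.finrank F (IntermediateField.adjoin F {c}) := by
  have hint' : IsIntegral F c' := by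
    by_contra hcon
    rw [minpoly.eq_zero hcon] at h
    exact minpoly.ne_zero hint h.symm
  rw [IntermediateField.adjoin.finrank hint, IntermediateField.adjoin.finrank hint', h]

theorem map_minpoly_of_isConjRoot (h : Module.finrank F (IntermediateField.adjoin F {c}) = 2)
    (hne : c' ≠ c) (hc : IsConjRoot F c c') :
    (minpoly F c).map (algebraMap F ℝ) = (X - C c) * (X - C c') := by
  obtain ⟨d, -, hm⟩ := exists_conj_of_finrank_eq_two h
  have h1 : eval c' ((minpoly F c).map (algebraMap F ℝ)) = 0 := by
    rw [eval_map_algebraMap, show minpoly F c = minpoly F c' from hc, minpoly.aeval]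
  rw [hm] at h1
  simp only [eval_mul, eval_sub, eval_X, eval_C, mul_eq_zero, sub_eq_zero, hne, false_or] at h1
  rw [hm, h1]

theorem X_sub_C_mem_lifts (a : F) : X - C (a : ℝ) ∈ lifts (algebraMap F ℝ) :=
  (mem_lifts _).2 ⟨X - C a, by simp; rfl⟩

theorem C_sub_X_mem_lifts (a : F) : C (a : ℝ) - X ∈ lifts (algebraMap F ℝ) :=
  (mem_lifts _).2 ⟨C a - X, by simp; rfl⟩

theorem mul_mem_lifts_of_isConjRoot (h : Module.finrank F (IntermediateField.adjoin F {c}) = 2)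
    (hne : c' ≠ c) (hc : IsConjRoot F c c') :
    (X - C c) * (X - C c') ∈ lifts (algebraMap F ℝ) :=
  (mem_lifts _).2 ⟨_, map_minpoly_of_isConjRoot h hne hc⟩

/-- Grouping `Z` by minimal polynomials, each group is the full root set, `{c}` or `{c, c'}`, of one
of them. -/
theorem prod_X_sub_C_mem_lifts {Z : Finset ℝ} (hZ : ∀ c ∈ Z, c ∈ F ∨
    (Module.finrank F (IntermediateField.adjoin F {c}) = 2 ∧ ∀ c', IsConjRoot F c c' → c' ∈ Z)) :
    ∏ c ∈ Z, (X - C c) ∈ lifts (algebraMap F ℝ) := by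
  classical
  refine (mem_lifts _).2 ⟨∏ m ∈ Z.image (minpoly F), m, ?_⟩
  rw [Polynomial.map_prod]
  refine Finset.prod_image' _ fun c hc => ?_
  rcases hZ c hc with hF | ⟨h2, hcl⟩
  · have hm : minpoly F c = X - C ⟨c, hF⟩ := minpoly.eq_X_sub_C ℝ (⟨c, hF⟩ : F)
    have : Z.filter (fun j => minpoly F j = minpoly F c) = {c} := by
      ext j
      simp only [Finset.mem_filter, Finset.mem_singleton]
      refine ⟨fun ⟨_, hj⟩ => ?_, fun hj => by subst hj; exact ⟨hc, rfl⟩⟩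
      have h0 := minpoly.aeval F j
      rw [hj, hm] at h0
      simp only [map_sub, aeval_X, aeval_C] at h0
      exact sub_eq_zero.1 h0
    rw [this, Finset.prod_singleton, hm]
    simp
    rfl
  · obtain ⟨c', hne, hm⟩ := exists_conj_of_finrank_eq_two h2
    have hint := isIntegral_of_finrank_eq_two h2
    have hroot : ∀ j, (aeval j (minpoly F c) = 0 ↔ j = c ∨ j = c') := by
      intro j
      rw [← eval_map_algebraMap, hm]
      simp [sub_eq_zero]
    have : Z.filter (fun j => minpoly F j = minpoly F c) = {c, c'} := by
      ext j
      simp only [Finset.mem_filter, Finset.mem_insert, Finset.mem_singleton]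
      constructor
      · rintro ⟨_, hj⟩
        rw [← hroot, ← hj, minpoly.aeval]
      · intro hj
        have := minpoly_eq_of_root hint ((hroot j).2 hj)
        exact ⟨hcl j this.symm, this⟩
    rw [this, Finset.prod_pair hne.symm, hm]

end Quadratic

/-- Played against `acc`: a quadratic boundary point cannot have gaps on both sides. -/
theorem not_accPt_of_gaps {K : Set ℝ} {u c v : ℝ} (huc : u < c) (hcv : c < v)
    (h1 : Set.Ioo u c ∩ K = ∅) (h2 : Set.Ioo c v ∩ K = ∅) : ¬ AccPt c (Filter.principal K) := by
  rw [accPt_iff_nhds]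
  intro h
  obtain ⟨y, ⟨⟨hy1, hy2⟩, hyK⟩, hne⟩ := h _ (Ioo_mem_nhds huc hcv)
  rcases lt_or_gt_of_ne hne with hlt | hlt
  · exact Set.notMem_empty y (h1 ▸ ⟨⟨hy1, hlt⟩, hyK⟩)
  · exact Set.notMem_empty y (h2 ▸ ⟨⟨hlt, hy2⟩, hyK⟩)

theorem accPt_of_mem_interior {K : Set ℝ} {c : ℝ} (h : c ∈ interior K) :
    AccPt c (Filter.principal K) := by
  rw [accPt_iff_nhds]
  intro U hU
  have h1 : ∀ᶠ y in nhdsWithin c (Set.Ioi c), y ∈ U ∩ K :=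
    nhdsWithin_le_nhds (Filter.inter_mem hU (mem_interior_iff_mem_nhds.1 h))
  obtain ⟨y, hy, hy'⟩ := (h1.and self_mem_nhdsWithin).exists
  exact ⟨y, hy, ne_of_gt hy'⟩

namespace HasQuadraticBoundary

variable {F : Subfield ℝ} {K : Set ℝ} {c c' : ℝ}

theorem mem_or_finrank (H : HasQuadraticBoundary F K) (hc : c ∈ frontier K) :
    c ∈ F ∨ Module.finrank F (IntermediateField.adjoin F {c}) = 2 := by
  have hr := H.rank_le c hc
  have hfin : FiniteDimensional F (IntermediateField.adjoin F {c}) :=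
    Module.rank_lt_aleph0_iff.1 (hr.trans_lt (by exact_mod_cast Cardinal.natCast_lt_aleph0 (n := 2)))
  have h2 : Module.finrank F (IntermediateField.adjoin F {c}) ≤ 2 :=
    Module.finrank_le_of_rank_le (by exact_mod_cast hr)
  have h0 : 0 < Module.finrank F (IntermediateField.adjoin F {c}) := Module.finrank_pos
  rcases (show Module.finrank F (IntermediateField.adjoin F {c}) = 1 ∨
    Module.finrank F (IntermediateField.adjoin F {c}) = 2 by omega) with h | h
  · rw [IntermediateField.finrank_adjoin_simple_eq_one_iff, IntermediateField.mem_bot] at h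
    obtain ⟨a, rfl⟩ := h
    exact Or.inl a.2
  · exact Or.inr h

theorem frontier_subset (H : HasQuadraticBoundary F K) (hc : c ∈ frontier K) : c ∈ K :=
  H.isClosed.frontier_subset hc

/-- Both orders of `c`, `c'` are treated at once: the interval with reversed endpoints is empty. -/
theorem conj_spec (H : HasQuadraticBoundary F K) (hc : c ∈ frontier K)
    (h2 : Module.finrank F (IntermediateField.adjoin F {c}) = 2) (h : IsConjRoot F c c') :
    c' ∈ frontier K ∧ ((¬ ∃ u v, IsQuadraticConjugatePair F u v ∧ K = Set.Icc u v) →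
      Set.Ioo c c' ∩ K = ∅ ∧ Set.Ioo c' c ∩ K = ∅) := by
  have h2' := (finrank_adjoin_eq_of_minpoly_eq (isIntegral_of_finrank_eq_two h2) h.symm).trans h2
  rcases lt_trichotomy c c' with hlt | rfl | hlt
  · have hp : IsQuadraticConjugatePair F c c' := ⟨hlt, h2, h⟩
    obtain ⟨-, h3, h4⟩ := H.conj c c' hp (Or.inl hc)
    refine ⟨h3, fun hex => ⟨h4.resolve_left fun hK => hex ⟨_, _, hp, hK⟩, ?_⟩⟩
    rw [Set.Ioo_eq_empty (not_lt.2 hlt.le), Set.empty_inter]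
  · exact ⟨hc, fun _ => by simp⟩
  · have hp : IsQuadraticConjugatePair F c' c := ⟨hlt, h2', h.symm⟩
    obtain ⟨h3, -, h4⟩ := H.conj c' c hp (Or.inr hc)
    refine ⟨h3, fun hex => ⟨?_, h4.resolve_left fun hK => hex ⟨_, _, hp, hK⟩⟩⟩
    rw [Set.Ioo_eq_empty (not_lt.2 hlt.le), Set.empty_inter]

theorem exists_isConjRoot (h : Module.finrank F (IntermediateField.adjoin F {c}) = 2) :
    ∃ c', c' ≠ c ∧ IsConjRoot F c c' := by
  obtain ⟨c', hne, hm⟩ := exists_conj_of_finrank_eq_two h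
  refine ⟨c', hne, (minpoly_eq_of_root (isIntegral_of_finrank_eq_two h) ?_).symm⟩
  rw [← eval_map_algebraMap, hm]
  simp

/-- Unless `K = [c, c']`, a quadratic boundary point and its conjugate bound a gap, and a gap on the
other side would isolate the point. So a least or greatest element lies in `F`, and a bounded gap
with a quadratic endpoint has conjugate endpoints. -/
theorem naturalGenerators_subset_lifts (H : HasQuadraticBoundary F K) {g : ℝ[X]}
    (hg : g ∈ naturalGenerators F K) : g ∈ lifts (algebraMap F ℝ) := by
  rcases hg with ⟨-, rfl⟩ | ⟨c, c', ⟨hlt, h2, hc⟩, -, rfl⟩ | ⟨hex, hg⟩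
  · exact one_mem _
  · obtain ⟨p, hp⟩ := (mem_lifts _).1 (mul_mem_lifts_of_isConjRoot h2 hlt.ne' hc)
    exact (mem_lifts _).2 ⟨-p, by rw [Polynomial.map_neg, hp]⟩
  · rcases hg with ⟨a, ha, hK, rfl⟩ | ⟨a, ha, hK, rfl⟩ | ⟨a, ha, b, hb, hab, hK, rfl⟩
    · rcases H.mem_or_finrank ha with h | h
      · exact X_sub_C_mem_lifts ⟨a, h⟩
      · obtain ⟨a', hne, hconj⟩ := exists_isConjRoot h
        obtain ⟨hfr, hgap⟩ := H.conj_spec ha h hconj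
        rcases lt_or_gt_of_ne hne with hlt | hlt
        · exact absurd (hK ▸ ⟨hlt, H.frontier_subset hfr⟩ : a' ∈ (∅ : Set ℝ)) (Set.notMem_empty _)
        · refine absurd (H.acc a ha h) (not_accPt_of_gaps (sub_one_lt a) hlt ?_ (hgap hex).1)
          exact Set.subset_eq_empty (Set.inter_subset_inter_left _ Set.Ioo_subset_Iio_self) hK
    · rcases H.mem_or_finrank ha with h | h
      · exact C_sub_X_mem_lifts ⟨a, h⟩
      · obtain ⟨a', hne, hconj⟩ := exists_isConjRoot h
        obtain ⟨hfr, hgap⟩ := H.conj_spec ha h hconj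
        rcases lt_or_gt_of_ne hne with hlt | hlt
        · refine absurd (H.acc a ha h) (not_accPt_of_gaps hlt (lt_add_one a) (hgap hex).2 ?_)
          exact Set.subset_eq_empty (Set.inter_subset_inter_left _ Set.Ioo_subset_Ioi_self) hK
        · exact absurd (hK ▸ ⟨hlt, H.frontier_subset hfr⟩ : a' ∈ (∅ : Set ℝ)) (Set.notMem_empty _)
    · have haK := H.frontier_subset ha
      have hbK := H.frontier_subset hb
      rcases H.mem_or_finrank ha with h | h
      · rcases H.mem_or_finrank hb with h' | h'
        · exact mul_mem (X_sub_C_mem_lifts ⟨a, h⟩) (X_sub_C_mem_lifts ⟨b, h'⟩)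
        · obtain ⟨b', hne, hconj⟩ := exists_isConjRoot h'
          obtain ⟨hfr, hgap⟩ := H.conj_spec hb h' hconj
          rcases lt_or_gt_of_ne hne with hlt | hlt
          · have : b' = a := by
              rcases lt_trichotomy b' a with h3 | h3 | h3
              · exact absurd ((hgap hex).2 ▸ ⟨⟨h3, hab⟩, haK⟩ : a ∈ (∅ : Set ℝ))
                  (Set.notMem_empty _)
              · exact h3
              · exact absurd (hK ▸ ⟨⟨h3, hlt⟩, H.frontier_subset hfr⟩ : b' ∈ (∅ : Set ℝ))
                  (Set.notMem_empty _)
            rw [mul_comm, ← this]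
            exact mul_mem_lifts_of_isConjRoot h' hne hconj
          · exact absurd (H.acc b hb h') (not_accPt_of_gaps hab hlt hK (hgap hex).1)
      · obtain ⟨a', hne, hconj⟩ := exists_isConjRoot h
        obtain ⟨hfr, hgap⟩ := H.conj_spec ha h hconj
        rcases lt_or_gt_of_ne hne with hlt | hlt
        · exact absurd (H.acc a ha h) (not_accPt_of_gaps hlt hab (hgap hex).2 hK)
        · have : a' = b := by
            rcases lt_trichotomy a' b with h3 | h3 | h3
            · exact absurd (hK ▸ ⟨⟨hlt, h3⟩, H.frontier_subset hfr⟩ : a' ∈ (∅ : Set ℝ))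
                (Set.notMem_empty _)
            · exact h3
            · exact absurd ((hgap hex).1 ▸ ⟨⟨hab, h3⟩, hbK⟩ : b ∈ (∅ : Set ℝ))
                (Set.notMem_empty _)
          rw [← this]
          exact mul_mem_lifts_of_isConjRoot h hne hconj

end HasQuadraticBoundary

theorem IsFiniteUnionOfClosedIntervals.isClosed {K : Set ℝ}
    (hK : IsFiniteUnionOfClosedIntervals K) : IsClosed K := by
  obtain ⟨I, hfin, hI, rfl⟩ := hK
  rw [Set.sUnion_eq_biUnion]
  refine hfin.isClosed_biUnion fun J hJ => ?_
  rcases hI J hJ with ⟨a, b, -, rfl⟩ | ⟨a, rfl⟩ | ⟨a, rfl⟩ | rfl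
  exacts [isClosed_Icc, isClosed_Ici, isClosed_Iic, isClosed_univ]

/-! ### From real terms to terms over `F`, for multiples of a fixed polynomial -/

section Preordering

variable {F : Subfield ℝ} {S : Set F[X]}

theorem preordering_add_mem {f g : F[X]} (hf : f ∈ preordering F S) (hg : g ∈ preordering F S) :
    f + g ∈ preordering F S :=
  AddSubmonoid.add_mem _ hf hg

theorem preordering_zero_mem : (0 : F[X]) ∈ preordering F S :=
  AddSubmonoid.zero_mem _

theorem sq_mul_prod_mem_preordering (q : F[X]) {E : Finset F[X]} (hE : (E : Set F[X]) ⊆ S) :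
    q ^ 2 * ∏ g ∈ E, g ∈ preordering F S :=
  AddSubmonoid.subset_closure ⟨1, q, E, zero_le_one, hE, by simp⟩

theorem C_mul_mem_preordering {a : F} (ha : 0 ≤ a) {f : F[X]} (hf : f ∈ preordering F S) :
    C a * f ∈ preordering F S := by
  induction hf using AddSubmonoid.closure_induction with
  | zero => rw [mul_zero]; exact preordering_zero_mem
  | add x y _ _ hx hy => rw [mul_add]; exact preordering_add_mem hx hy
  | mem x hx =>
    obtain ⟨b, q, E, hb, hE, rfl⟩ := hx
    exact AddSubmonoid.subset_closure ⟨a * b, q, E, mul_nonneg ha hb, hE, by rw [C_mul]; ring⟩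

theorem sq_mul_mem_preordering (q : F[X]) {f : F[X]} (hf : f ∈ preordering F S) :
    q ^ 2 * f ∈ preordering F S := by
  induction hf using AddSubmonoid.closure_induction with
  | zero => rw [mul_zero]; exact preordering_zero_mem
  | add x y _ _ hx hy => rw [mul_add]; exact preordering_add_mem hx hy
  | mem x hx =>
    obtain ⟨b, r, E, hb, hE, rfl⟩ := hx
    exact AddSubmonoid.subset_closure ⟨b, q * r, E, hb, hE, by ring⟩

end Preordering

/-- The sums of terms `s² ∏_{g ∈ E} g` of degree at most `D`, where `s` is a real polynomial and
`E` is a finite set of elements of `S`. -/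
noncomputable def realTruncation {F : Subfield ℝ} (S : Set F[X]) (D : ℕ) : AddSubmonoid ℝ[X] :=
  AddSubmonoid.closure {p | ∃ (s : ℝ[X]) (E : Finset F[X]), (E : Set F[X]) ⊆ S ∧
    p = s ^ 2 * (∏ g ∈ E, g).map (algebraMap F ℝ) ∧ p.natDegree ≤ D}

section Coefficients

variable {α : Type*} [TopologicalSpace α]

theorem continuous_coeff_mul {P Q : α → ℝ[X]} (hP : ∀ n, Continuous fun a => (P a).coeff n)
    (hQ : ∀ n, Continuous fun a => (Q a).coeff n) (n : ℕ) :
    Continuous fun a => (P a * Q a).coeff n := by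
  simp only [coeff_mul]
  exact continuous_finsetSum _ fun i _ => (hP _).mul (hQ _)

theorem continuous_coeff_ofFn (k n : ℕ) :
    Continuous fun v : Fin k → ℝ => (ofFn k v).coeff n := by
  by_cases h : n < k
  · simp only [ofFn_coeff_eq_val_of_lt _ h]
    fun_prop
  · simp only [ofFn_coeff_eq_zero_of_ge _ (not_lt.1 h)]
    exact continuous_const

theorem map_ofFn {R R' : Type*} [Semiring R] [Semiring R'] [DecidableEq R] [DecidableEq R']
    (f : R →+* R') {n : ℕ} (v : Fin n → R) : (ofFn n v).map f = ofFn n fun i => f (v i) := by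
  ext i
  rw [coeff_map]
  by_cases h : i < n
  · rw [ofFn_coeff_eq_val_of_lt _ h, ofFn_coeff_eq_val_of_lt _ h]
  · rw [ofFn_coeff_eq_zero_of_ge _ (not_lt.1 h), ofFn_coeff_eq_zero_of_ge _ (not_lt.1 h), map_zero]

end Coefficients

theorem prod_X_sub_C_dvd {k : Type*} [Field k] {Z : Finset k} {f : k[X]}
    (h : ∀ c ∈ Z, f.eval c = 0) : ∏ c ∈ Z, (X - C c) ∣ f :=
  Finset.prod_dvd_of_coprime
    (fun _ _ _ _ hne => isCoprime_X_sub_C_of_isUnit_sub (sub_ne_zero.2 hne).isUnit)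
    fun c hc => dvd_iff_isRoot.2 (h c hc)

/-- Let `p` be a squarefree polynomial over `F` with the real roots `Z`. If all real multiples of
`p` near `p * h` lie in the truncated real preordering, then `p * h` lies in the preordering
over `F`. -/
theorem mul_mem_preordering_of_eventually {F : Subfield ℝ} {S : Set F[X]} {Z : Finset ℝ}
    (hS : ∀ g ∈ S, ∀ c ∈ Z, 0 ≤ aeval c g) {p : F[X]}
    (hp : p.map (algebraMap F ℝ) = ∏ c ∈ Z, (X - C c))
    (hr : ∀ G : F[X], ∏ c ∈ Z with aeval c G ≠ 0, (X - C c) ∈ lifts (algebraMap F ℝ))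
    {m : ℕ} {h : F[X]} (hm : h.natDegree ≤ m)
    (hev : ∀ᶠ y in nhds (toFn (m + 1) (h.map (algebraMap F ℝ))),
      p.map (algebraMap F ℝ) * ofFn (m + 1) y ∈ realTruncation S (p.natDegree + m)) :
    p * h ∈ preordering F S := by
  classical
  have hp0 : p.map (algebraMap F ℝ) ≠ 0 := by
    rw [hp]; exact (monic_prod_X_sub_C _ _).ne_zero
  have hp0' : p ≠ 0 := fun h0 => hp0 (by rw [h0, Polynomial.map_zero])
  -- The cone is taken in the space of cofactors of `p`, where the given point is interior.
  let A : AddSubmonoid (Fin (m + 1) → F) :=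
    { carrier := {v | p * ofFn (m + 1) v ∈ preordering F S}
      zero_mem' := by
        simp only [Set.mem_ofPred_eq, map_zero, mul_zero]
        exact preordering_zero_mem
      add_mem' := by
        intro a b ha hb
        simp only [Set.mem_ofPred_eq, map_add, mul_add] at ha hb ⊢
        exact preordering_add_mem ha hb }
  have hAmem : ∀ v, v ∈ A ↔ p * ofFn (m + 1) v ∈ preordering F S := fun v => Iff.rfl
  have hAs : ∀ a : F, 0 ≤ a → ∀ v ∈ A, a • v ∈ A := by
    intro a ha v hv
    rw [hAmem] at hv ⊢
    rw [map_smul, smul_eq_C_mul, mul_left_comm]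
    exact C_mul_mem_preordering ha hv
  let emb : (Fin (m + 1) → F) →+ (Fin (m + 1) → ℝ) :=
    { toFun := fun v i => (v i : ℝ)
      map_zero' := by ext; simp
      map_add' := by intros; ext; simp }
  -- All terms are nonnegative on `Z`, so a sum vanishing on `Z` has only terms vanishing on `Z`.
  -- This allows divisibility by `p` to be used term by term.
  have hcone : ∀ P ∈ realTruncation S (p.natDegree + m), (∀ c ∈ Z, 0 ≤ P.eval c) ∧
      ((∀ c ∈ Z, P.eval c = 0) → ∃ y ∈ (A.map emb).topologicalClosure,
        P = p.map (algebraMap F ℝ) * ofFn (m + 1) y) := by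
    intro P hP
    induction hP using AddSubmonoid.closure_induction with
    | zero => exact ⟨by simp, fun _ => ⟨0, zero_mem _, by simp⟩⟩
    | add P Q _ _ hP hQ =>
      refine ⟨fun c hc => by rw [eval_add]; exact add_nonneg (hP.1 c hc) (hQ.1 c hc), fun h0 => ?_⟩
      have h1 : ∀ c ∈ Z, P.eval c = 0 ∧ Q.eval c = 0 := by
        intro c hc
        have := h0 c hc
        rw [eval_add] at this
        constructor <;> linarith [hP.1 c hc, hQ.1 c hc]
      obtain ⟨y, hy, rfl⟩ := hP.2 fun c hc => (h1 c hc).1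
      obtain ⟨y', hy', rfl⟩ := hQ.2 fun c hc => (h1 c hc).2
      exact ⟨y + y', add_mem hy hy', by rw [map_add, mul_add]⟩
    | mem P hP =>
      obtain ⟨s, E, hE, rfl, hd⟩ := hP
      have hG : ∀ c ∈ Z, 0 ≤ aeval c (∏ g ∈ E, g) := by
        intro c hc
        rw [map_prod]
        exact Finset.prod_nonneg fun g hg => hS g (hE hg) c hc
      refine ⟨fun c hc => ?_, fun h0 => ?_⟩
      · rw [eval_mul, eval_pow, eval_map_algebraMap]
        exact mul_nonneg (sq_nonneg _) (hG c hc)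
      set G := ∏ g ∈ E, g with hGdef
      rcases eq_or_ne (s ^ 2 * G.map (algebraMap F ℝ)) 0 with hz | hnz
      · exact ⟨0, zero_mem _, by rw [hz]; simp⟩
      -- `r` collects the points of `Z` where `G` does not vanish; there `s` must vanish, so `r`
      -- divides `s`. Every point of `Z` is then a root of `r` or of `G`.
      obtain ⟨r, hrm⟩ := (mem_lifts _).1 (hr G)
      have hrs : r.map (algebraMap F ℝ) ∣ s := by
        rw [hrm]
        refine prod_X_sub_C_dvd fun c hc => ?_
        obtain ⟨hcZ, hcG⟩ := Finset.mem_filter.1 hc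
        have := h0 c hcZ
        rw [eval_mul, eval_pow, eval_map_algebraMap] at this
        simpa [hcG] using this
      obtain ⟨u, rfl⟩ := hrs
      have hdvd : p ∣ r ^ 2 * G := by
        rw [← map_dvd_map' (algebraMap F ℝ), hp]
        refine prod_X_sub_C_dvd fun c hc => ?_
        rw [Polynomial.map_mul, eval_mul, eval_map_algebraMap, eval_map_algebraMap]
        by_cases hcG : aeval c G = 0
        · rw [hcG, mul_zero]
        · have : aeval c r = 0 := by
            rw [← eval_map_algebraMap, hrm, eval_prod]
            exact Finset.prod_eq_zero (Finset.mem_filter.2 ⟨hc, hcG⟩) (by simp)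
          rw [map_pow, this]
          simp
      obtain ⟨B, hB⟩ := hdvd
      have hmapB : (r.map (algebraMap F ℝ)) ^ 2 * G.map (algebraMap F ℝ) =
          p.map (algebraMap F ℝ) * B.map (algebraMap F ℝ) := by
        rw [← Polynomial.map_pow, ← Polynomial.map_mul, hB, Polynomial.map_mul]
      have hP : (r.map (algebraMap F ℝ) * u) ^ 2 * G.map (algebraMap F ℝ) =
          p.map (algebraMap F ℝ) * (u ^ 2 * B.map (algebraMap F ℝ)) := by
        linear_combination u ^ 2 * hmapB
      rw [hP] at hnz hd ⊢
      have hnz' := right_ne_zero_of_mul hnz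
      rw [natDegree_mul hp0 hnz', natDegree_map] at hd
      rw [natDegree_mul (left_ne_zero_of_mul hnz') (right_ne_zero_of_mul hnz'), natDegree_pow,
        natDegree_map] at hd
      set k := u.natDegree with hk
      -- The cofactor `u ^ 2 * B` depends continuously on the coefficients of `u`, while `B` is
      -- defined over `F`. Those `u` with coefficients in `F` are dense and give points of `A`; `hd`
      -- bounds the degree by `m`.
      let Φ : (Fin (k + 1) → ℝ) → (Fin (m + 1) → ℝ) := fun a =>
        toFn (m + 1) (ofFn (k + 1) a ^ 2 * B.map (algebraMap F ℝ))
      have hΦ : Continuous Φ := by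
        refine continuous_pi fun i => ?_
        change Continuous fun a : Fin (k + 1) → ℝ =>
          (ofFn (k + 1) a ^ 2 * B.map (algebraMap F ℝ)).coeff i
        simp only [pow_two]
        exact continuous_coeff_mul (continuous_coeff_mul (continuous_coeff_ofFn _)
          (continuous_coeff_ofFn _)) (fun _ => continuous_const) _
      have hdense : DenseRange fun (v : Fin (k + 1) → F) i => algebraMap F ℝ (v i) :=
        DenseRange.piMap fun _ => F.denseRange_algebraMap
      have hΦF : Φ '' Set.range (fun (v : Fin (k + 1) → F) i => algebraMap F ℝ (v i)) ⊆
          A.map emb := by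
        rintro _ ⟨_, ⟨v, rfl⟩, rfl⟩
        have hdv : (ofFn (k + 1) v ^ 2 * B).natDegree < m + 1 := by
          have h1 := ofFn_natDegree_lt (n := k + 1) (by omega) v
          have h2 := natDegree_mul_le (p := ofFn (k + 1) v ^ 2) (q := B)
          have h3 := natDegree_pow_le (p := ofFn (k + 1) v) (n := 2)
          omega
        refine ⟨toFn (m + 1) (ofFn (k + 1) v ^ 2 * B), ?_, ?_⟩
        · change p * ofFn (m + 1) (toFn (m + 1) (ofFn (k + 1) v ^ 2 * B)) ∈ preordering F S
          rw [ofFn_comp_toFn_eq_id_of_natDegree_lt hdv, mul_left_comm, ← hB]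
          have := sq_mul_prod_mem_preordering (ofFn (k + 1) v * r) hE
          rw [← hGdef] at this
          convert this using 1
          ring
        · ext i
          change algebraMap F ℝ ((ofFn (k + 1) v ^ 2 * B).coeff i) =
            (ofFn (k + 1) (fun i => algebraMap F ℝ (v i)) ^ 2 * B.map (algebraMap F ℝ)).coeff i
          rw [← map_ofFn, ← Polynomial.map_pow, ← Polynomial.map_mul, coeff_map]
      refine ⟨Φ (toFn (k + 1) u), ?_, ?_⟩
      · have h1 : Φ (toFn (k + 1) u) ∈ Φ '' closure (Set.range
            fun (v : Fin (k + 1) → F) i => algebraMap F ℝ (v i)) :=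
          ⟨_, hdense _, rfl⟩
        exact closure_mono hΦF (image_closure_subset_closure_image hΦ h1)
      · simp only [Φ]
        rw [ofFn_comp_toFn_eq_id_of_natDegree_lt (p := u) (by omega),
          ofFn_comp_toFn_eq_id_of_natDegree_lt]
        have h2 := natDegree_mul_le (p := u ^ 2) (q := B.map (algebraMap F ℝ))
        have h3 := natDegree_pow_le (p := u) (n := 2)
        rw [natDegree_map] at h2
        omega
  have hmem : toFn (m + 1) h ∈ A := by
    refine mem_of_closure_mem_nhds A hAs _ ?_
    have heq : (fun i => ((toFn (m + 1) h i : F) : ℝ)) =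
        toFn (m + 1) (h.map (algebraMap F ℝ)) := by
      ext i
      change algebraMap F ℝ (h.coeff i) = (h.map (algebraMap F ℝ)).coeff i
      rw [coeff_map]
    rw [heq]
    filter_upwards [hev] with y hy
    obtain ⟨y', hy', hyy⟩ := (hcone _ hy).2 fun c hc => by
      rw [eval_mul, hp, eval_prod, Finset.prod_eq_zero hc (by simp), zero_mul]
    rw [injective_ofFn _ (mul_left_cancel₀ hp0 hyy)]
    exact hy'
  rw [hAmem, ofFn_comp_toFn_eq_id_of_natDegree_lt (by omega)] at hmem
  exact hmem

/-! ### Stability of signs under small changes of the coefficients -/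

theorem exists_pow_le_mul_abs_eval {L : Set ℝ} (hL : IsClosed L) {h : ℝ[X]}
    (hne : ∀ x ∈ L, h.eval x ≠ 0) {m i : ℕ} (hi : i ≤ m)
    (hm : m = h.natDegree ∨ Bornology.IsBounded L) :
    ∃ B, ∀ x ∈ L, |x| ^ i ≤ B * |h.eval x| := by
  obtain ⟨R, B₀, hR⟩ : ∃ R B₀ : ℝ, ∀ x ∈ L, R < |x| → |x| ^ i ≤ B₀ * |h.eval x| := by
    -- For large `|x|`, either `x ^ i` is dominated by `h` because `i` is at most its degree, or `L`
    -- has no such points.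
    rcases hm with rfl | hb
    · rcases L.eq_empty_or_nonempty with rfl | ⟨x₀, hx₀⟩
      · exact ⟨0, 0, fun x hx => absurd hx (Set.notMem_empty x)⟩
      have h0 : h ≠ 0 := fun h0 => hne x₀ hx₀ (by simp [h0])
      have hO : (X ^ i : ℝ[X]).eval =O[Bornology.cobounded ℝ] h.eval := by
        refine isBigO_cobounded_of_degree_le ?_
        rw [degree_X_pow, degree_eq_natDegree h0]
        exact_mod_cast hi
      obtain ⟨B₀, hB₀⟩ := hO.bound
      rw [Filter.Eventually, ← Bornology.isCobounded_def, ← Bornology.isBounded_compl_iff] at hB₀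
      obtain ⟨R, hR⟩ := hB₀.exists_norm_le
      refine ⟨R, B₀, fun x _ hx => ?_⟩
      by_contra hcon
      refine absurd (hR x ?_) (not_le.2 hx)
      intro hmem
      apply hcon
      simpa using hmem
    · obtain ⟨R, hR⟩ := hb.exists_norm_le
      exact ⟨R, 0, fun x hx hx' => absurd (hR x hx) (not_le.2 hx')⟩
  have hK : IsCompact (L ∩ Metric.closedBall 0 R) := (isCompact_closedBall 0 R).inter_left hL
  obtain ⟨B₁, hB₁⟩ := hK.exists_bound_of_continuousOn (f := fun x => |x| ^ i / |h.eval x|)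
    (ContinuousOn.div (by fun_prop) (h.continuous.abs.continuousOn)
      fun x hx => abs_ne_zero.2 (hne x hx.1))
  refine ⟨max B₀ B₁, fun x hx => ?_⟩
  have hpos : 0 < |h.eval x| := abs_pos.2 (hne x hx)
  by_cases hxR : R < |x|
  · exact (hR x hx hxR).trans (mul_le_mul_of_nonneg_right (le_max_left _ _) hpos.le)
  · have h1 := hB₁ x ⟨hx, by simpa using not_lt.1 hxR⟩
    rw [Real.norm_eq_abs, abs_of_nonneg (by positivity), div_le_iff₀ hpos] at h1
    exact h1.trans (mul_le_mul_of_nonneg_right (le_max_right _ _) hpos.le)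

theorem eval_ofFn {n : ℕ} (v : Fin n → ℝ) (x : ℝ) :
    (ofFn n v).eval x = ∑ i, v i * x ^ (i : ℕ) := by
  rw [ofFn_eq_sum_monomial, eval_finsetSum]
  simp [eval_monomial]

/-- On `L` each monomial of degree at most `m` is bounded by a multiple of `|h|`, so one
neighbourhood of the coefficients serves all of `L`, even if `L` is unbounded. -/
theorem eventually_abs_sub_le {L : Set ℝ} (hL : IsClosed L) {h : ℝ[X]}
    (hne : ∀ x ∈ L, h.eval x ≠ 0) {m : ℕ} (hdeg : h.natDegree ≤ m)
    (hm : m = h.natDegree ∨ Bornology.IsBounded L) :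
    ∀ᶠ y in nhds (toFn (m + 1) h), ∀ x ∈ L,
      |(ofFn (m + 1) y).eval x - h.eval x| ≤ |h.eval x| := by
  choose B hB using fun i : Fin (m + 1) =>
    exists_pow_le_mul_abs_eval hL hne (Nat.lt_succ_iff.1 i.2) hm
  have hcont : Continuous fun y : Fin (m + 1) → ℝ => ∑ i, |y i - toFn (m + 1) h i| * B i := by
    fun_prop
  have hlt : ∀ᶠ y in nhds (toFn (m + 1) h), ∑ i, |y i - toFn (m + 1) h i| * B i < 1 :=
    hcont.continuousAt.eventually (gt_mem_nhds (by simp))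
  filter_upwards [hlt] with y hy x hx
  have h1 : (ofFn (m + 1) y).eval x - h.eval x =
      ∑ i, (y i - toFn (m + 1) h i) * x ^ (i : ℕ) := by
    conv_lhs => rw [← ofFn_comp_toFn_eq_id_of_natDegree_lt (p := h) (Nat.lt_succ_iff.2 hdeg)]
    rw [eval_ofFn, eval_ofFn, ← Finset.sum_sub_distrib]
    exact Finset.sum_congr rfl fun i _ => by ring
  rw [h1]
  calc |∑ i, (y i - toFn (m + 1) h i) * x ^ (i : ℕ)|
      ≤ ∑ i, |(y i - toFn (m + 1) h i) * x ^ (i : ℕ)| := Finset.abs_sum_le_sum_abs _ _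
    _ ≤ ∑ i, |y i - toFn (m + 1) h i| * B i * |h.eval x| := by
        refine Finset.sum_le_sum fun i _ => ?_
        rw [abs_mul, abs_pow, mul_assoc]
        exact mul_le_mul_of_nonneg_left (hB i x hx) (abs_nonneg _)
    _ = (∑ i, |y i - toFn (m + 1) h i| * B i) * |h.eval x| := by rw [Finset.sum_mul]
    _ ≤ |h.eval x| := mul_le_of_le_one_left (abs_nonneg _) hy.le

theorem mul_nonneg_of_abs_sub_le {a b w : ℝ} (hb : b ≠ 0) (hab : 0 ≤ a * b)
    (hw : |w - b| ≤ |b|) : 0 ≤ a * w := by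
  rcases lt_or_gt_of_ne hb with hlt | hlt
  · rw [abs_of_neg hlt, abs_le] at hw
    exact mul_nonneg_of_nonpos_of_nonpos (by nlinarith) (by linarith)
  · rw [abs_of_pos hlt, abs_le] at hw
    exact mul_nonneg (nonneg_of_mul_nonneg_left hab hlt) (by linarith)

/-! ### Splitting off squares, and the descent to `F` -/

namespace HasQuadraticBoundary

variable {F : Subfield ℝ} {K : Set ℝ}

/-- At a root which is not isolated in `K`, the square of a minimal polynomial can be split off. -/
theorem nonneg_of_minpoly_sq_mul (H : HasQuadraticBoundary F K) {c : ℝ} (hint : IsIntegral F c)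
    (hacc : AccPt c (Filter.principal K)) {g : F[X]}
    (hf : ∀ x ∈ K, 0 ≤ aeval x (minpoly F c ^ 2 * g)) : ∀ x ∈ K, 0 ≤ aeval x g := by
  have hne : ∀ x ∈ K, aeval x (minpoly F c) ≠ 0 → 0 ≤ aeval x g := by
    intro x hx h0
    have := hf x hx
    rw [map_mul, map_pow] at this
    exact nonneg_of_mul_nonneg_right this (by positivity)
  intro x hx
  by_cases h0 : aeval x (minpoly F c) = 0
  · have hmin := minpoly_eq_of_root hint h0
    -- Other roots of the minimal polynomial in `K` are accumulation points too: a root in `F` is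
    -- `c` itself, a quadratic boundary point is one by `acc`, and an interior point always is.
    have hxacc : AccPt x (Filter.principal K) := by
      by_cases hfr : x ∈ frontier K
      · rcases H.mem_or_finrank hfr with h | h
        · have : c = x := by
            have h1 := minpoly.aeval F c
            rw [← hmin, show minpoly F x = X - C ⟨x, h⟩ from
              minpoly.eq_X_sub_C ℝ (⟨x, h⟩ : F)] at h1
            simp only [map_sub, aeval_X, aeval_C] at h1
            exact sub_eq_zero.1 h1
          exact this ▸ hacc
        · exact H.acc x hfr h
      · exact accPt_of_mem_interior (by_contra fun hi => hfr ⟨subset_closure hx, hi⟩)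
    have hfin : Set.Finite {y : ℝ | aeval y (minpoly F c) = 0} := by
      refine ((minpoly F c).aroots ℝ).toFinset.finite_toSet.subset fun y hy => ?_
      simpa [minpoly.ne_zero hint] using hy
    have hfreq : ∃ᶠ y in nhds x, y ∈ {y | 0 ≤ aeval y g} := by
      have h1 := accPt_iff_frequently.1 hxacc
      have h2 : ∀ᶠ y in nhds x, y ∉ {y : ℝ | aeval y (minpoly F c) = 0} \ {x} :=
        (hfin.sdiff (t := {x})).isClosed.isOpen_compl.mem_nhds (by simp)
      refine (h1.and_eventually h2).mono fun y hy => hne y hy.1.2 fun h3 => ?_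
      exact hy.2 ⟨h3, hy.1.1⟩
    have hcl : IsClosed {y : ℝ | 0 ≤ aeval y g} :=
      isClosed_le continuous_const (Polynomial.continuous_aeval g)
    have hmem := mem_closure_iff_frequently.2 hfreq
    rw [hcl.closure_eq] at hmem
    exact hmem
  · exact hne x hx h0

/-- `f` has a local minimum at `c`, so its derivative vanishes there. That of the minimal polynomial
does not, by separability, so the cofactor vanishes at `c`. -/
theorem minpoly_sq_dvd_of_mem_interior {c : ℝ} {f : F[X]} (hf : ∀ x ∈ K, 0 ≤ aeval x f)
    (hint : IsIntegral F c) (hc : c ∈ interior K) (h0 : aeval c f = 0) : minpoly F c ^ 2 ∣ f := by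
  obtain ⟨g, rfl⟩ := minpoly.dvd F c h0
  have hmin : IsLocalMin (fun x => ((minpoly F c * g).map (algebraMap F ℝ)).eval x) c := by
    filter_upwards [mem_interior_iff_mem_nhds.1 hc] with x hx
    rw [eval_map_algebraMap, eval_map_algebraMap, h0]
    exact hf x hx
  have hd := hmin.deriv_eq_zero
  rw [Polynomial.deriv, derivative_map, eval_map_algebraMap, derivative_mul, map_add, map_mul,
    map_mul, minpoly.aeval, zero_mul, add_zero, mul_eq_zero] at hd
  have hsep : (minpoly F c).Separable := (minpoly.irreducible hint).separable
  have := hd.resolve_left (hsep.aeval_derivative_ne_zero (minpoly.aeval F c))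
  rw [pow_two]
  exact mul_dvd_mul_left _ (minpoly.dvd F c this)

/-- The passage from real preorderings of bounded degree to the preordering over `F`. -/
theorem mem_preordering_of_nonneg (H : HasQuadraticBoundary F K) {S : Set F[X]}
    (hS : ∀ g ∈ S, ∀ x ∈ K, 0 ≤ aeval x g)
    (hsat : ∀ d : ℕ, ∃ D, d ≤ D ∧ (D = d ∨ Bornology.IsBounded K) ∧
      ∀ P : ℝ[X], P.natDegree ≤ D → (∀ x ∈ K, 0 ≤ P.eval x) → P ∈ realTruncation S D)
    (f : F[X]) (hf : ∀ x ∈ K, 0 ≤ aeval x f) : f ∈ preordering F S := by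
  classical
  induction hn : f.natDegree using Nat.strong_induction_on generalizing f with
  | _ n ih =>
  subst hn
  rcases eq_or_ne f 0 with rfl | hf0
  · exact preordering_zero_mem
  have hint : ∀ {c : ℝ}, aeval c f = 0 → IsIntegral F c := fun {c} hc =>
    (show IsAlgebraic F c from ⟨f, hf0, hc⟩).isIntegral
  -- Only accumulation points are used: at an isolated point of `K` the quotient could be negative.
  by_cases hA : ∃ c ∈ K, AccPt c (Filter.principal K) ∧ aeval c f = 0 ∧ minpoly F c ^ 2 ∣ f
  · obtain ⟨c, -, hacc, hc0, g, hg⟩ := hA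
    have hi := hint hc0
    subst hg
    have hgK := H.nonneg_of_minpoly_sq_mul hi hacc hf
    refine sq_mul_mem_preordering _ (ih _ ?_ g hgK rfl)
    rw [natDegree_mul (left_ne_zero_of_mul hf0) (right_ne_zero_of_mul hf0), natDegree_pow]
    have := minpoly.natDegree_pos hi
    omega
  push Not at hA
  set Z : Finset ℝ := (f.aroots ℝ).toFinset.filter (· ∈ K) with hZdef
  have hZ : ∀ c, c ∈ Z ↔ c ∈ K ∧ aeval c f = 0 := by
    intro c
    simp [hZdef, hf0, and_comm]
  have hfront : ∀ c ∈ Z, c ∈ frontier K := by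
    intro c hc
    obtain ⟨hcK, hc0⟩ := (hZ c).1 hc
    refine ⟨subset_closure hcK, fun hi => ?_⟩
    exact hA c hcK (accPt_of_mem_interior hi) hc0
      (minpoly_sq_dvd_of_mem_interior hf (hint hc0) hi hc0)
  have hconj : ∀ {c c' : ℝ} {G : F[X]}, IsConjRoot F c c' → aeval c G = 0 → aeval c' G = 0 := by
    intro c c' G hcc h0
    obtain ⟨q, rfl⟩ := minpoly.dvd F c h0
    rw [show minpoly F c = minpoly F c' from hcc, map_mul, minpoly.aeval, zero_mul]
  have hr : ∀ G : F[X], ∏ c ∈ Z with aeval c G ≠ 0, (X - C c) ∈ lifts (algebraMap F ℝ) := by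
    intro G
    refine prod_X_sub_C_mem_lifts fun c hc => ?_
    obtain ⟨hcZ, hcG⟩ := Finset.mem_filter.1 hc
    refine (H.mem_or_finrank (hfront c hcZ)).imp_right fun h2 => ⟨h2, fun c' hc' => ?_⟩
    have hfr := (H.conj_spec (hfront c hcZ) h2 hc').1
    exact Finset.mem_filter.2 ⟨(hZ c').2 ⟨H.frontier_subset hfr, hconj hc' ((hZ c).1 hcZ).2⟩,
      fun h0 => hcG (hconj hc'.symm h0)⟩
  obtain ⟨p, hp⟩ : ∃ p : F[X], p.map (algebraMap F ℝ) = ∏ c ∈ Z, (X - C c) := by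
    -- For `G = 1` the filter keeps all of `Z`.
    have := (mem_lifts _).1 (hr 1)
    simpa using this
  have hpf : p ∣ f := by
    rw [← map_dvd_map' (algebraMap F ℝ), hp]
    refine prod_X_sub_C_dvd fun c hc => ?_
    rw [eval_map_algebraMap]
    exact ((hZ c).1 hc).2
  have hpZ : ∀ c ∈ Z, aeval c p = 0 := by
    intro c hc
    rw [← eval_map_algebraMap, hp, eval_prod]
    exact Finset.prod_eq_zero hc (by simp)
  obtain ⟨h, rfl⟩ := hpf
  have hp0 := left_ne_zero_of_mul hf0
  have hh0 := right_ne_zero_of_mul hf0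
  -- A zero of `h` here would be an accumulation point of `K` in `Z`; with the root of `p` it would
  -- give a squared minimal polynomial, against `hA`. At isolated points of `K` in `Z`, `h` may
  -- vanish.
  have hL : ∀ x ∈ closure (K \ Z), (h.map (algebraMap F ℝ)).eval x ≠ 0 := by
    intro x hx hx0
    rw [eval_map_algebraMap] at hx0
    have hxK : x ∈ K := H.isClosed.closure_subset_iff.2 Set.sdiff_subset hx
    have hxf : aeval x (p * h) = 0 := by rw [map_mul, hx0, mul_zero]
    have hxZ : x ∈ Z := (hZ x).2 ⟨hxK, hxf⟩
    refine hA x hxK ?_ hxf ?_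
    · rw [accPt_iff_nhds]
      intro U hU
      obtain ⟨y, hyU, hyK, hyZ⟩ := mem_closure_iff_nhds.1 hx U hU
      exact ⟨y, ⟨hyU, hyK⟩, fun h => hyZ (h ▸ hxZ)⟩
    · rw [pow_two]
      exact mul_dvd_mul (minpoly.dvd F x (hpZ x hxZ)) (minpoly.dvd F x hx0)
  -- `D` may exceed the degree only for bounded `K`: on an unbounded set a new top coefficient,
  -- however small, could change the sign at infinity.
  obtain ⟨D, hD, hDb, hsatD⟩ := hsat (p * h).natDegree
  have hdeg := natDegree_mul hp0 hh0
  obtain ⟨m, rfl⟩ : ∃ m, D = p.natDegree + m := ⟨D - p.natDegree, by omega⟩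
  refine mul_mem_preordering_of_eventually (Z := Z) (m := m)
    (fun g hg c hc => hS g hg c ((hZ c).1 hc).1) hp hr (by omega) ?_
  have hm : m = (h.map (algebraMap F ℝ)).natDegree ∨ Bornology.IsBounded (closure (K \ Z)) := by
    refine hDb.imp (fun h1 => by rw [natDegree_map]; omega) fun hb => ?_
    exact (hb.subset Set.sdiff_subset).closure
  filter_upwards [eventually_abs_sub_le isClosed_closure hL
    (by rw [natDegree_map]; omega) hm] with y hy
  refine hsatD _ ?_ fun x hx => ?_
  · refine natDegree_mul_le.trans ?_
    rw [natDegree_map]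
    have := ofFn_natDegree_lt (n := m + 1) (by omega) y
    omega
  · rw [eval_mul]
    by_cases hxZ : x ∈ Z
    · rw [eval_map_algebraMap, hpZ x hxZ, zero_mul]
    · have hxL : x ∈ closure (K \ Z) := subset_closure ⟨hx, hxZ⟩
      refine mul_nonneg_of_abs_sub_le (hL x hxL) ?_ (hy x hxL)
      rw [← eval_mul, ← Polynomial.map_mul, eval_map_algebraMap]
      exact hf x hx

end HasQuadraticBoundary

/-! ### The natural generators, the exceptional interval and the conclusion -/

theorem naturalGenerators_nonneg {F : Subfield ℝ} {K : Set ℝ} {g : ℝ[X]}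
    (hg : g ∈ naturalGenerators F K) {x : ℝ} (hx : x ∈ K) : 0 ≤ g.eval x := by
  rcases hg with ⟨-, rfl⟩ | ⟨c, c', -, rfl, rfl⟩ | ⟨-, ⟨a, -, h, rfl⟩ | ⟨a, -, h, rfl⟩ |
    ⟨a, -, b, -, hab, h, rfl⟩⟩
  · simp
  · simp only [eval_neg, eval_mul, eval_sub, eval_X, eval_C]
    nlinarith [mul_nonneg (sub_nonneg.2 hx.1) (sub_nonneg.2 hx.2)]
  · simp only [eval_sub, eval_X, eval_C, sub_nonneg]
    by_contra hcon
    exact Set.notMem_empty x (h ▸ ⟨not_le.1 hcon, hx⟩)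
  · simp only [eval_sub, eval_X, eval_C, sub_nonneg]
    by_contra hcon
    exact Set.notMem_empty x (h ▸ ⟨not_le.1 hcon, hx⟩)
  · simp only [eval_mul, eval_sub, eval_X, eval_C]
    have hout : x ≤ a ∨ b ≤ x := by
      by_contra hcon
      push Not at hcon
      exact Set.notMem_empty x (h ▸ ⟨hcon, hx⟩)
    rcases hout with h | h
    · exact mul_nonneg_of_nonpos_of_nonpos (by linarith) (by linarith)
    · exact mul_nonneg (by linarith) (by linarith)

theorem preordering_subset_posPolynomials {F : Subfield ℝ} {K : Set ℝ} {S : Set F[X]}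
    (hS : ∀ g ∈ S, ∀ x ∈ K, 0 ≤ aeval x g) : preordering F S ⊆ posPolynomials F K := by
  intro f hf x hx
  induction hf using AddSubmonoid.closure_induction with
  | zero => simp
  | add f g _ _ hf hg => rw [map_add]; exact add_nonneg hf hg
  | mem f hf =>
    obtain ⟨a, q, E, ha, hE, rfl⟩ := hf
    rw [map_mul, map_mul, aeval_C, map_pow, map_prod]
    exact mul_nonneg (mul_nonneg ha (sq_nonneg _))
      (Finset.prod_nonneg fun g hg => hS g (hE hg) x hx)

theorem truncatedPreordering_le_realTruncation {F : Subfield ℝ} {N : Set ℝ[X]}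
    (hN : ∀ g ∈ N, g ∈ lifts (algebraMap F ℝ)) {S : Set F[X]}
    (hS : ∀ p : F[X], p.map (algebraMap F ℝ) ∈ N → p ∈ S) (D : ℕ) :
    truncatedPreordering N D ≤ realTruncation S D := by
  classical
  refine AddSubmonoid.closure_mono ?_
  rintro _ ⟨q, E, hE, rfl, hd⟩
  have hinj := map_injective (algebraMap F ℝ) (algebraMap F ℝ).injective
  refine ⟨q, E.preimage (Polynomial.map (algebraMap F ℝ)) hinj.injOn, ?_, ?_, hd⟩
  · intro p hp
    exact hS p (hE (by simpa using hp))
  · rw [Polynomial.map_prod, Finset.prod_preimage (Polynomial.map (algebraMap F ℝ)) E hinj.injOn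
      (fun g => g)]
    intro g hg hnot
    exact absurd ((mem_lifts _).1 (hN g (hE hg))) hnot

theorem gapGenerators_Icc_subset {c c' : ℝ} (h : c < c') :
    gapGenerators (Set.Icc c c') ⊆ {X - C c, C c' - X} := by
  have hfr : ∀ x ∈ frontier (Set.Icc c c'), x = c ∨ x = c' := by
    intro x hx
    rw [frontier_Icc h.le] at hx
    simpa using hx
  rintro g (⟨a, ha, hK, rfl⟩ | ⟨a, ha, hK, rfl⟩ | ⟨a, ha, b, hb, hab, hK, rfl⟩)
  · rcases hfr a ha with rfl | rfl
    · simp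
    · exact absurd (hK ▸ ⟨h, le_rfl, h.le⟩ : c ∈ (∅ : Set ℝ)) (Set.notMem_empty _)
  · rcases hfr a ha with rfl | rfl
    · exact absurd (hK ▸ ⟨h, h.le, le_rfl⟩ : c' ∈ (∅ : Set ℝ)) (Set.notMem_empty _)
    · simp
  · obtain ⟨x, hx⟩ := exists_between hab
    have h1 := hfr a ha
    have h2 := hfr b hb
    refine absurd (hK ▸ ⟨hx, ?_, ?_⟩ : x ∈ (∅ : Set ℝ)) (Set.notMem_empty _)
    · rcases h1 with rfl | rfl <;> linarith [hx.1]
    · rcases h2 with rfl | rfl <;> linarith [hx.2]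

/-- In even degrees, the linear generators of `[c, c']` can be replaced by `-(X - c)(X - c')`. -/
theorem truncatedPreordering_Icc_le_realTruncation {F : Subfield ℝ} {S : Set F[X]} {c c' : ℝ}
    (h : c < c') {p : F[X]} (hpS : p ∈ S)
    (hp : p.map (algebraMap F ℝ) = -((X - C c) * (X - C c'))) (k : ℕ) :
    truncatedPreordering (gapGenerators (Set.Icc c c')) (2 * k) ≤ realTruncation S (2 * k) := by
  classical
  have hsq : ∀ s : ℝ[X], s.natDegree ≤ k → s ^ 2 ∈ realTruncation S (2 * k) := fun s hs =>
    AddSubmonoid.subset_closure ⟨s, ∅, by simp, by simp,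
      natDegree_pow_le.trans (Nat.mul_le_mul_left 2 hs)⟩
  have hdp : (-((X - C c) * (X - C c')) : ℝ[X]).natDegree = 2 := by
    rw [natDegree_neg, natDegree_mul (X_sub_C_ne_zero c) (X_sub_C_ne_zero c')]; simp
  have hgen : ∀ s : ℝ[X], s.natDegree + 1 ≤ k →
      s ^ 2 * -((X - C c) * (X - C c')) ∈ realTruncation S (2 * k) := by
    intro s hs
    refine AddSubmonoid.subset_closure ⟨s, {p}, by simpa, by simp [hp], ?_⟩
    refine natDegree_mul_le.trans ?_
    have := natDegree_pow_le (p := s) (n := 2)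
    omega
  have hκ : C (√(c' - c))⁻¹ ^ 2 * (C c' - C c) = (1 : ℝ[X]) := by
    have h1 : 0 < c' - c := sub_pos.2 h
    rw [← C_pow, ← C_sub, ← C_mul, inv_pow, Real.sq_sqrt h1.le, inv_mul_cancel₀ h1.ne', C_1]
  have hlin : ∀ (s l : ℝ[X]), l.natDegree = 1 → (s ^ 2 * l).natDegree ≤ 2 * k →
      (l = X - C c ∨ l = C c' - X) → s ^ 2 * l ∈ realTruncation S (2 * k) := by
    intro s l hl hd hcase
    rcases eq_or_ne s 0 with rfl | hs
    · rw [zero_pow two_ne_zero, zero_mul]; exact zero_mem _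
    have hl0 : l ≠ 0 := fun h0 => by simp [h0] at hl
    rw [natDegree_mul (pow_ne_zero 2 hs) hl0, natDegree_pow, hl] at hd
    have hds : (C (√(c' - c))⁻¹ * s).natDegree ≤ s.natDegree := natDegree_C_mul_le _ _
    have hdl := natDegree_mul_le (p := C (√(c' - c))⁻¹ * s) (q := l)
    -- This is `(c' - c) * l = l ^ 2 + (X - c) * (c' - X)`, with the scalar absorbed into the
    -- squares. As `s ^ 2 * l` has odd degree at most `2 * k`, the degree of `s` is less than `k`,
    -- so both new terms fit.
    have : s ^ 2 * l = (C (√(c' - c))⁻¹ * s * l) ^ 2 +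
        (C (√(c' - c))⁻¹ * s) ^ 2 * -((X - C c) * (X - C c')) := by
      rcases hcase with rfl | rfl
      · linear_combination (-(s ^ 2 * (X - C c))) * hκ
      · linear_combination (-(s ^ 2 * (C c' - X))) * hκ
    rw [this]
    exact add_mem (hsq _ (by omega)) (hgen _ (by omega))
  refine (AddSubmonoid.closure_le).2 ?_
  rintro _ ⟨s, E, hE, rfl, hd⟩
  have hE' : E = ∅ ∨ E = {X - C c} ∨ E = {C c' - X} ∨ E = {X - C c, C c' - X} := by
    have := Set.subset_pair_iff_eq.1 (hE.trans (gapGenerators_Icc_subset h))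
    exact_mod_cast this
  have hlc : (X - C c : ℝ[X]).natDegree = 1 := natDegree_X_sub_C c
  have hlc' : (C c' - X : ℝ[X]).natDegree = 1 := by
    rw [← neg_sub, natDegree_neg, natDegree_X_sub_C]
  have hne : (X - C c : ℝ[X]) ≠ C c' - X := by
    intro h0
    have := congrArg (eval c) h0
    simp at this
    linarith
  rcases hE' with rfl | rfl | rfl | rfl
  · rcases eq_or_ne s 0 with rfl | hs
    · simp
    · simp only [Finset.prod_empty, mul_one, natDegree_pow] at hd ⊢
      exact hsq s (by omega)
  · rw [Finset.prod_singleton] at hd ⊢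
    exact hlin s _ hlc hd (Or.inl rfl)
  · rw [Finset.prod_singleton] at hd ⊢
    exact hlin s _ hlc' hd (Or.inr rfl)
  · rw [Finset.prod_pair hne] at hd ⊢
    have heq : (X - C c) * (C c' - X) = -((X - C c) * (X - C c')) := by ring
    rw [heq] at hd ⊢
    rcases eq_or_ne s 0 with rfl | hs
    · simp
    · rw [natDegree_mul (pow_ne_zero 2 hs) (fun h0 => by simp [h0] at hdp), natDegree_pow,
        hdp] at hd
      exact hgen s (by omega)

theorem theorem8p5 (F : Subfield ℝ) (K : Set ℝ) (hK : IsFiniteUnionOfClosedIntervals K)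
    (hne : K.Nonempty)
    (hdeg : ∀ c ∈ frontier K, Module.rank F (IntermediateField.adjoin F {c}) ≤ 2)
    (hconj : ∀ c c' : ℝ, IsQuadraticConjugatePair F c c' →
      (c ∈ frontier K ∨ c' ∈ frontier K) →
      c ∈ frontier K ∧ c' ∈ frontier K ∧ (K = Set.Icc c c' ∨ Set.Ioo c c' ∩ K = ∅))
    (hiso : ∀ c ∈ frontier K, Module.finrank F (IntermediateField.adjoin F {c}) = 2 →
      AccPt c (Filter.principal K)) :
    (∀ g ∈ naturalGenerators F K, ∃ p : F[X], p.map (algebraMap F ℝ) = g) ∧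
      posPolynomials F K =
        preordering F {p : F[X] | p.map (algebraMap F ℝ) ∈ naturalGenerators F K} := by
  have H : HasQuadraticBoundary F K := ⟨hK.isClosed, hdeg, hconj, hiso⟩
  have hlift : ∀ g ∈ naturalGenerators F K, ∃ p : F[X], p.map (algebraMap F ℝ) = g :=
    fun g hg => (mem_lifts g).1 (H.naturalGenerators_subset_lifts hg)
  have hS : ∀ g ∈ {p : F[X] | p.map (algebraMap F ℝ) ∈ naturalGenerators F K}, ∀ x ∈ K,
      0 ≤ aeval x g := by
    intro g hg x hx
    rw [← eval_map_algebraMap]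
    exact naturalGenerators_nonneg hg hx
  refine ⟨hlift, Set.Subset.antisymm ?_ (preordering_subset_posPolynomials hS)⟩
  refine H.mem_preordering_of_nonneg hS ?_
  have hreal : ∀ (D : ℕ) (P : ℝ[X]), P.natDegree ≤ D → (∀ x ∈ K, 0 ≤ P.eval x) →
      P ∈ truncatedPreordering (gapGenerators K) D := fun D P hd hP =>
    truncatedPreordering.mono hd (mem_truncatedPreordering_of_nonneg hK.isClosed hne P hP)
  by_cases hex : ∃ c c' : ℝ, IsQuadraticConjugatePair F c c' ∧ K = Set.Icc c c'
  · obtain ⟨c, c', hpair, rfl⟩ := hex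
    have hg : -((X - C c) * (X - C c')) ∈ naturalGenerators F (Set.Icc c c') :=
      Or.inr (Or.inl ⟨c, c', hpair, rfl, rfl⟩)
    obtain ⟨p, hp⟩ := hlift _ hg
    -- An even bound is needed to replace the linear generators; `K` is bounded, so raising the
    -- degree is allowed.
    refine fun d => ⟨2 * d, by omega, Or.inr (Metric.isBounded_Icc c c'), fun P hd hP => ?_⟩
    refine truncatedPreordering_Icc_le_realTruncation hpair.1 ?_ hp d (hreal _ P hd hP)
    rwa [Set.mem_ofPred_eq, hp]
  · have hsub : gapGenerators K ⊆ naturalGenerators F K := fun g hg => Or.inr (Or.inr ⟨hex, hg⟩)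
    refine fun d => ⟨d, le_rfl, Or.inl rfl, fun P hd hP => ?_⟩
    exact truncatedPreordering_le_realTruncation (fun g hg => (mem_lifts g).2 (hlift g (hsub hg)))
      (fun p hp => hsub hp) d (hreal _ P hd hP)
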